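/- **Setting.** Let $X\subseteq\mathbb R^n$ be convex, $\Phi:\mathbb R^n\times S\to\mathbb R$ be measurable, and let $P$ be a probability measure on $S$. The objective $f:\mathbb R^n\to\mathbb R$ and the constant $L_0\ge 0$ are given by one of the following. 1. *(no decision dependence)* $\Phi=F$, each $F(x,\cdot)$ is $P$-integrable, $f(x)=\mathbb E_{\xi\sim P}[F(x,\xi)]$, $F(\cdot,\xi)$ is convex on $\mathbb R^n$ for $P$-almost every $\xi$, and $\|F(x,\cdot)-F(y,\cdot)\|_{L^2(P)}\le L_0\|x-y\|$ for all $x,y\in\mathbb R^n$. 2. *(decision dependence, available density)* $\mathcal D(x)$ is a law with density $p(\cdot\mid x)$ with respect to a $\sigma$-finite reference measure (Lebesgue measure on $\mathbb R^d$, for instance), positive on a set $\Xi(x)$ and zero off it; $f(x)=\mathbb E_{\xi\sim\mathcal D(x)}[\hat F(x,\xi)]$ is convex on $\mathbb R^n$; $\tilde p$ is a probability density, positive on every $\Xi(x)$, $P$ has density $\tilde p$, and $\Phi(x,\xi)=\hat F(x,\xi)p(\xi\mid x)/\tilde p(\xi)$. For all $x,y\in\mathbb R^n$: $D_{\rm KL}(\mathcal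 D(x)\|\mathcal D(y))+D_{\rm KL}(\mathcal D(y)\|\mathcal D(x))\le L_\xi^2\|x-y\|^2$; $p(\xi\mid x)/\tilde p(\xi)\le M$ on $\Xi(x)$; $\|\hat F(x,\cdot)-\hat F(y,\cdot)\|_{L^2(P)}\le\hat L_f\|x-y\|$; $|\hat F(x,\xi)|\le M_f$ for almost every $\xi\in\Xi(x)$. Here $L_0=\sqrt{2(M^2\hat L_f^2+MM_f^2L_\xi^2)}$. 3. *(decision dependence, unavailable density)* On $(S,P)$ there is a jointly measurable $\mathbb R^d$-valued random field $(\xi_x)_{x\in\mathbb R^n}$ with $\xi_x\sim\mathcal D(x)$; $\Phi(x,s)=\hat F(x,\xi_x(s))$ with each $\hat F(x,\cdot)$ integrable under $\mathcal D(x)$; $f(x)=\mathbb E_{\xi\sim\mathcal D(x)}[\hat F(x,\xi)]$ is convex on $\mathbb R^n$; and $\|\hat F(x,\xi_x)-\hat F(y,\xi_y)\|_{L^2(P)}\le L_0\|x-y\|$ for all $x,y\in\mathbb R^n$. For $\eta>0$, define the gradient estimator $\tilde g_\eta(x,v,z,s)\in\mathbb R^n$ by $$\tilde g^i_\eta(x,v,z,s)=\frac{\Phi\big((x_i+\eta\sqrt{2v},\,x^{-i}-z^{-i}),s\big)-\Phi\big((x_i-\eta\sqrt{2v},\,x^{-i}-z^{-i}),s\big)}{\eta\sqrt{2\pi}},\qquad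 1\le i\le n,$$ where $(x_i\pm\eta\sqrt{2v},x^{-i}-z^{-i})$ has $i$-th coordinate $x_i\pm\eta\sqrt{2v}$ and $j$-th coordinate $x_j-z_j$ for $j\ne i$. Given $x_0\in X$ (possibly random), let $$x_{k+1}=\Pi_X\big[x_k-\gamma_k\,\tilde g_{\eta_k}(x_k,V_k,Z_k,s_k)\big],\qquad k\ge 0,$$ where $\Pi_X[u]$ is a nearest point of $X$ to $u$ (assumed to exist whenever it is used, as it does if $X$ is closed), $V_k\sim\mathcal Exp(1)$, $Z_k\sim\mathcal N_n(0,\eta_k^2I)$, $s_k\sim P$, and all $V_k,Z_k,s_k$ ($k\ge0$) and $x_0$ are independent. **Proposition.** Suppose that $f$ is $\mu$-strongly convex on $X$ with $\mu>0$ and that the set of minimizers of $f$ over $X$ is nonempty. Then $f$ has a unique minimizer $x^*$ over $X$, and the following hold. (a) If $\gamma_k,\eta_k>0$ for all $k\ge 0$, $\sum_k\gamma_k=\infty$, $\sum_k\gamma_k^2<\infty$ and $\sum_k\gamma_k\eta_k<\infty$, then $x_k\to x^*$ almost surely. (b) If $\gamma_k=\eta_k=\theta/k$ for all $k\ge1$,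 where $\theta>1/\mu$, and $\gamma_0\ge0$, $\eta_0>0$ are arbitrary ($\gamma_0=0$ means that the scheme starts at $k=1$ from $x_1=x_0$), then $\mathbb E\|x_k-x^*\|^2<\infty$ for all $k\ge 0$, $\mathbb E\|x_k-x^*\|\to0$ and, with $a_0\ge 0$ given by $a_0^2=\mathbb E\|x_0-x^*\|^2$ (so $a_0=\|x_0-x^*\|$ for deterministic $x_0$), for all $k\ge1$ $$\mathbb E\|x_k-x^*\|^2\le\frac{\max\Big\{\theta^2\big(4L_0\sqrt{n+1}+\tfrac{8L_0^2n}{\pi}\big)(\mu\theta-1)^{-1},\ a_0^2\Big\}}{k}.$$ Moreover $\mathbb E\|x_k-x^*\|^2\le C\,n/k$ for all $k\ge1$, where $C$ depends only on $L_0,\mu,\theta,a_0$. -/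

import Mathlib

open MeasureTheory ProbabilityTheory Filter Topology
open scoped ENNReal

noncomputable section

/-- The perturbed point whose `i`-th coordinate is `x i + t` and whose `j`-th coordinate, `j ≠ i`,
is `x j - z j`. -/
def perturbedPoint {n : ℕ} (x z : EuclideanSpace ℝ (Fin n)) (i : Fin n) (t : ℝ) :
    EuclideanSpace ℝ (Fin n) :=
  WithLp.toLp 2 (Function.update (fun j => x j - z j) i (x i + t))

/-- The exponentially-shifted Gaussian smoothing gradient estimator built from the
sample function `Φ`: its `i`-th component is
`(Φ (x_i + η √(2v), x^{-i} - z^{-i}) s - Φ (x_i - η √(2v), x^{-i} - z^{-i}) s) / (η √(2π))`. -/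
def esGsEstimator {n : ℕ} {S : Type*} (Φ : EuclideanSpace ℝ (Fin n) → S → ℝ) (η : ℝ)
    (x : EuclideanSpace ℝ (Fin n)) (v : ℝ) (z : EuclideanSpace ℝ (Fin n)) (s : S) :
    EuclideanSpace ℝ (Fin n) :=
  WithLp.toLp 2 fun i =>
    (Φ (perturbedPoint x z i (η * √(2 * v))) s - Φ (perturbedPoint x z i (-(η * √(2 * v)))) s)
      / (η * √(2 * Real.pi))

/-- The optimal set of the problem of minimizing `f` over `X`. -/
def optimalSet {n : ℕ} (f : EuclideanSpace ℝ (Fin n) → ℝ) (X : Set (EuclideanSpace ℝ (Fin n))) :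
    Set (EuclideanSpace ℝ (Fin n)) :=
  {x | x ∈ X ∧ ∀ y ∈ X, f x ≤ f y}

/-- `p` is a Euclidean projection (nearest point) of `u` on `X`. -/
def IsProjection {n : ℕ} (X : Set (EuclideanSpace ℝ (Fin n))) (u p : EuclideanSpace ℝ (Fin n)) :
    Prop :=
  p ∈ X ∧ ∀ y ∈ X, ‖u - p‖ ≤ ‖u - y‖

/-- The setting without decision dependence: `f x = 𝔼[F(x, ξ)]` with `ξ ∼ P`, where `F(·, ξ)` is
convex for almost every `ξ` and `L₀`-Lipschitz in the norm of `L²(P)`. -/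
structure StandardSetting {n : ℕ} {S : Type*} [MeasurableSpace S] (P : Measure S)
    (F : EuclideanSpace ℝ (Fin n) → S → ℝ) (f : EuclideanSpace ℝ (Fin n) → ℝ) (L₀ : ℝ) :
    Prop where
  measurable : Measurable (Function.uncurry F)
  integrable : ∀ x, Integrable (F x) P
  f_eq : ∀ x, f x = ∫ s, F x s ∂P
  lipschitz : ∀ x y, eLpNorm (fun s => F x s - F y s) 2 P ≤ ENNReal.ofReal (L₀ * ‖x - y‖)
  convex : ∀ᵐ s ∂P, ConvexOn ℝ Set.univ (fun x => F x s)

/-- The decision-dependent setting with available density: the law `𝒟(x)` of the noise under the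
decision `x` has density `p x`, carried by `Ξ x`, with respect to the reference measure `ν`
(Lebesgue measure when the noise takes values in `ℝᵈ`), `f x = 𝔼_{ξ ∼ 𝒟(x)}[F̂(x, ξ)]`, and noise is
sampled from a fixed density `q`. -/
structure KnownDensitySetting {n : ℕ} {S : Type*} [MeasurableSpace S] (ν : Measure S)
    (Ξ : EuclideanSpace ℝ (Fin n) → Set S) (p : EuclideanSpace ℝ (Fin n) → S → ℝ) (q : S → ℝ)
    (Fhat : EuclideanSpace ℝ (Fin n) → S → ℝ) (f : EuclideanSpace ℝ (Fin n) → ℝ)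
    (Lξ Lf M Mf : ℝ) : Prop where
  sigmaFinite : SigmaFinite ν
  measurable_Fhat : Measurable (Function.uncurry Fhat)
  measurable_p : Measurable (Function.uncurry p)
  measurable_q : Measurable q
  measurableSet_Ξ : ∀ x, MeasurableSet (Ξ x)
  p_pos : ∀ x, ∀ s ∈ Ξ x, 0 < p x s
  p_eq_zero : ∀ x, ∀ s ∉ Ξ x, p x s = 0
  lintegral_p : ∀ x, ∫⁻ s, ENNReal.ofReal (p x s) ∂ν = 1
  q_nonneg : ∀ s, 0 ≤ q s
  q_pos : ∀ x, ∀ s ∈ Ξ x, 0 < q s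
  lintegral_q : ∫⁻ s, ENNReal.ofReal (q s) ∂ν = 1
  Lξ_nonneg : 0 ≤ Lξ
  Lf_nonneg : 0 ≤ Lf
  klDiv_sym_le : ∀ x y,
    InformationTheory.klDiv (ν.withDensity fun s => ENNReal.ofReal (p x s))
        (ν.withDensity fun s => ENNReal.ofReal (p y s))
      + InformationTheory.klDiv (ν.withDensity fun s => ENNReal.ofReal (p y s))
        (ν.withDensity fun s => ENNReal.ofReal (p x s))
      ≤ ENNReal.ofReal (Lξ ^ 2 * ‖x - y‖ ^ 2)
  ratio_le : ∀ x, ∀ s ∈ Ξ x, p x s / q s ≤ M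
  lipschitz : ∀ x y, eLpNorm (fun s => Fhat x s - Fhat y s) 2
      (ν.withDensity fun s => ENNReal.ofReal (q s)) ≤ ENNReal.ofReal (Lf * ‖x - y‖)
  bounded : ∀ x, ∀ᵐ s ∂(ν.restrict (Ξ x)), |Fhat x s| ≤ Mf
  f_eq : ∀ x, f x = ∫ s, Fhat x s ∂(ν.withDensity fun s => ENNReal.ofReal (p x s))
  convex : ConvexOn ℝ Set.univ f

/-- The decision-dependent setting with unavailable density: on the sample space `(S, P)` there is
a random field `ξ x`, `x ∈ ℝⁿ`, with values in `ℝᵈ`, whose marginal `ξ x` has the law `𝒟(x)`,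
`f x = 𝔼_{ξ ∼ 𝒟(x)}[F̂(x, ξ)]`, and `x ↦ F̂(x, ξ x)` is `L₀`-Lipschitz in the norm of `L²(P)`. -/
structure RandomFieldSetting {n d : ℕ} {S : Type*} [MeasurableSpace S] (P : Measure S)
    (ξ : EuclideanSpace ℝ (Fin n) → S → EuclideanSpace ℝ (Fin d))
    (𝒟 : EuclideanSpace ℝ (Fin n) → Measure (EuclideanSpace ℝ (Fin d)))
    (Fhat : EuclideanSpace ℝ (Fin n) → EuclideanSpace ℝ (Fin d) → ℝ)
    (f : EuclideanSpace ℝ (Fin n) → ℝ) (L₀ : ℝ) : Prop where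
  measurable_ξ : Measurable (Function.uncurry ξ)
  measurable_Fhat : Measurable (Function.uncurry Fhat)
  marginal : ∀ x, P.map (ξ x) = 𝒟 x
  integrable : ∀ x, Integrable (Fhat x) (𝒟 x)
  f_eq : ∀ x, f x = ∫ t, Fhat x t ∂(𝒟 x)
  lipschitz : ∀ x y, eLpNorm (fun s => Fhat x (ξ x s) - Fhat y (ξ y s)) 2 P
      ≤ ENNReal.ofReal (L₀ * ‖x - y‖)
  convex : ConvexOn ℝ Set.univ f

/-- The three settings of the zeroth-order scheme, each with the probability space `(S, P)` from
which one sample is drawn per iteration, the function `Φ x s` that is evaluated in the gradient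
estimator, the objective `f` and the constant `L₀`. -/
def IsAdmissible {n : ℕ} {S : Type*} [MeasurableSpace S] (P : Measure S)
    (Φ : EuclideanSpace ℝ (Fin n) → S → ℝ) (f : EuclideanSpace ℝ (Fin n) → ℝ) (L₀ : ℝ) : Prop :=
  StandardSetting P Φ f L₀ ∨
  (∃ (ν : Measure S) (Ξ : EuclideanSpace ℝ (Fin n) → Set S)
      (p : EuclideanSpace ℝ (Fin n) → S → ℝ) (q : S → ℝ)
      (Fhat : EuclideanSpace ℝ (Fin n) → S → ℝ) (Lξ Lf M Mf : ℝ),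
      KnownDensitySetting ν Ξ p q Fhat f Lξ Lf M Mf ∧
      P = ν.withDensity (fun s => ENNReal.ofReal (q s)) ∧
      (∀ x s, Φ x s = Fhat x s * p x s / q s) ∧
      L₀ = √(2 * (M ^ 2 * Lf ^ 2 + M * Mf ^ 2 * Lξ ^ 2))) ∨
  (∃ (d : ℕ) (ξ : EuclideanSpace ℝ (Fin n) → S → EuclideanSpace ℝ (Fin d))
      (𝒟 : EuclideanSpace ℝ (Fin n) → Measure (EuclideanSpace ℝ (Fin d)))
      (Fhat : EuclideanSpace ℝ (Fin n) → EuclideanSpace ℝ (Fin d) → ℝ),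
      RandomFieldSetting P ξ 𝒟 Fhat f L₀ ∧ (∀ x s, Φ x s = Fhat x (ξ x s)))

/-- `x` is a run of the projected zeroth-order stochastic gradient scheme
`x_{k+1} = Π_X [x_k - γ_k g̃_{η_k}(x_k, V_k, Z_k, s_k)]` on the probability space `(Ω, Pr)`:
the triples `(V_k, Z_k, s_k)` are independent over `k` and of the initial iterate `x_0 ∈ X`, and the
law of the `k`-th one is `Exp(1) ⊗ 𝒩(0, η_k² I) ⊗ P`. -/
structure IsRun {n : ℕ} {S Ω : Type*} [MeasurableSpace S] [MeasurableSpace Ω]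
    (X : Set (EuclideanSpace ℝ (Fin n))) (P : Measure S)
    (Φ : EuclideanSpace ℝ (Fin n) → S → ℝ) (γ η : ℕ → ℝ) (Pr : Measure Ω)
    (V : ℕ → Ω → ℝ) (Z : ℕ → Ω → EuclideanSpace ℝ (Fin n)) (s : ℕ → Ω → S)
    (x : ℕ → Ω → EuclideanSpace ℝ (Fin n)) : Prop where
  measurable_V : ∀ k, Measurable (V k)
  measurable_Z : ∀ k, Measurable (Z k)
  measurable_s : ∀ k, Measurable (s k)
  law : ∀ k, Pr.map (fun ω => (V k ω, Z k ω, s k ω)) =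
    (expMeasure 1).prod ((multivariateGaussian 0 ((η k) ^ 2 • (1 : Matrix (Fin n) (Fin n) ℝ))).prod P)
  indep : iIndepFun (fun k ω => (V k ω, Z k ω, s k ω)) Pr
  measurable_init : Measurable (x 0)
  indep_init : IndepFun (x 0) (fun ω k => (V k ω, Z k ω, s k ω)) Pr
  init_mem : ∀ ω, x 0 ω ∈ X
  step : ∀ k ω, IsProjection X
    (x k ω - γ k • esGsEstimator Φ (η k) (x k ω) (V k ω) (Z k ω) (s k ω)) (x (k + 1) ω)

/-- The step-size and smoothing sequences are positive with `∑ γ_k = ∞`, `∑ γ_k² < ∞` and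
`∑ γ_k η_k < ∞`. -/
structure StepSequences (γ η : ℕ → ℝ) : Prop where
  γ_pos : ∀ k, 0 < γ k
  η_pos : ∀ k, 0 < η k
  sum_γ : Tendsto (fun N => ∑ k ∈ Finset.range N, γ k) atTop atTop
  sum_γ_sq : Summable fun k => γ k ^ 2
  sum_γ_η : Summable fun k => γ k * η k

end

open scoped NNReal RealInnerProductSpace

/-! All three settings reduce to one, `MeanSquareLipschitz`: `Φ` has mean `f` and is `L₀`-Lipschitz
in mean square, and `f` is convex on the whole space; by Jensen, `f` is then `L₀`-Lipschitz. Only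
the density setting takes work: there the increment of the importance weight is controlled by the
symmetrised Kullback–Leibler divergence, because the logarithmic mean is at most the maximum
(`sq_sub_le_mul_log_sub`).

The estimator is unbiased for the gradient of the Gaussian smoothing `f_η(x) = E f(x + w)`. If `v ∼
Exp(1)`, then `η√(2v)` has on `t > 0` a density proportional to `t` times the Gaussian one, so the
symmetric difference of `H` averages to a multiple of `E[H(T) T]` with `T ∼ N(0, η²)`. Putting `T`
in place of the `i`-th coordinate of the Gaussian vector yields `η⁻² E[f(x + w) w_i]`
(`integral_esGsEstimator`). `f_η` is never differentiated: Stein's identity on the convex slices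
along `x - y` gives directly `η⁻² E[f(x + w)⟨x - y, w⟩] ≥ f_η(x) - f_η(y) ≥ f(x) - f(y) - L₀η√n`.
The second moment of the estimator is at most `4L₀²n/π`, uniformly in `η`.

Together with quadratic growth at the minimizer and nonexpansiveness of the projection, this bounds
the conditional expectation of `‖x_{k+1} - x*‖²` by `(1 - μγ)‖x_k - x*‖² + 2L₀√n γη + (4L₀²n/π)γ²`.
Moreover a function that is strongly convex and Lipschitz on `X` forces `X` to be bounded, `‖x - x*‖
≤ 4L₀/(3μ)`, so the iterates have all moments.

For (a), the squared distance corrected by the summable error terms is, up to sign, a bounded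
submartingale, hence converges almost surely; the weighted sum of the expectations is finite while
`∑ γ_k = ∞`, so the limit is zero. For (b), induction gives `Q/k` once `k > μθ`, and the diameter
bound covers the earlier steps; for `n ≥ 1` the first entry of the maximum is already large enough
for both. -/

lemma LipschitzWith.memLp_of_memLp_id {E : Type*} [NormedAddCommGroup E] [MeasurableSpace E]
    [BorelSpace E] [SecondCountableTopology E] {ρ : Measure E} [IsFiniteMeasure ρ] {p : ℝ≥0∞}
    (hρ : MemLp id p ρ)
    {K : ℝ≥0} {f : E → ℝ} (hf : LipschitzWith K f) : MemLp f p ρ := by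
  have h1 : MemLp (fun x : E => f x - f 0) p ρ := by
    refine hρ.of_le_mul (c := K) (hf.continuous.aestronglyMeasurable.sub aestronglyMeasurable_const)
      (Eventually.of_forall fun x => ?_)
    simpa using hf.norm_sub_le x 0
  refine (h1.add (memLp_const (f 0))).ae_eq (Eventually.of_forall fun x => ?_)
  simp

/-! ### Stein's identity for one real Gaussian variable. -/

lemma hasDerivAt_gaussianPDFReal (v : ℝ≥0) (t : ℝ) :
    HasDerivAt (gaussianPDFReal 0 v) (-(t / v) * gaussianPDFReal 0 v t) t := by
  rw [gaussianPDFReal_def]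
  have h : HasDerivAt (fun x : ℝ => -(x - 0) ^ 2 / (2 * (v : ℝ))) (-(t / v)) t := by
    have := (((hasDerivAt_id t).sub_const 0).pow 2).neg.div_const (2 * (v : ℝ))
    refine this.congr_deriv ?_
    rcases eq_or_ne (v : ℝ) 0 with hv | hv
    · simp [hv]
    · simp; field_simp
  exact (h.exp.const_mul _).congr_deriv (by ring)

lemma tendsto_id_mul_gaussianPDFReal {v : ℝ≥0} (hv : v ≠ 0) :
    Tendsto (fun t => t * gaussianPDFReal 0 v t) atTop (𝓝 0) := by
  have hv' : (0 : ℝ) < v := by positivity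
  set c : ℝ := (√(2 * Real.pi * v))⁻¹
  have hb : ∀ t : ℝ, 0 < t → t * gaussianPDFReal 0 v t ≤ (c * (2 * v)) * t⁻¹ := by
    intro t ht
    -- The crude bound `exp(-r) ≤ 1/r` at `r = t²/(2v)` already leaves a decay of order `1/t`.
    have h1 := Real.add_one_le_exp (t ^ 2 / (2 * v))
    have h2 : Real.exp (-(t - 0) ^ 2 / (2 * v)) = (Real.exp (t ^ 2 / (2 * v)))⁻¹ := by
      rw [← Real.exp_neg]; congr 1; ring
    have h3 : Real.exp (-(t - 0) ^ 2 / (2 * v)) ≤ (2 * v) / t ^ 2 := by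
      rw [h2, ← inv_div (t ^ 2) (2 * (v : ℝ))]
      exact inv_anti₀ (by positivity) (by linarith)
    rw [gaussianPDFReal_def]
    calc t * (c * Real.exp (-(t - 0) ^ 2 / (2 * v))) ≤ t * (c * ((2 * v) / t ^ 2)) := by gcongr
      _ = _ := by field_simp
  refine squeeze_zero' (g := fun t => (c * (2 * v)) * t⁻¹) ?_ ?_ ?_
  · filter_upwards [eventually_gt_atTop 0] with t ht
    exact mul_nonneg ht.le (gaussianPDFReal_nonneg _ _ _)
  · filter_upwards [eventually_gt_atTop 0] with t ht using hb t ht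
  · simpa using tendsto_inv_atTop_zero.const_mul (c * (2 * (v : ℝ)))

lemma gaussianPDFReal_neg_arg (v : ℝ≥0) (t : ℝ) :
    gaussianPDFReal 0 v (-t) = gaussianPDFReal 0 v t := by
  simp [gaussianPDFReal_def]

lemma integrable_gaussianReal_iff {v : ℝ≥0} (hv : v ≠ 0) {f : ℝ → ℝ} :
    Integrable f (gaussianReal 0 v) ↔ Integrable (fun t => f t * gaussianPDFReal 0 v t) := by
  rw [gaussianReal_of_var_ne_zero _ hv]
  have := integrable_withDensity_iff (μ := volume) (f := gaussianPDF 0 v) (g := f)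
    (measurable_gaussianPDF 0 v) (Eventually.of_forall fun x => gaussianPDF_lt_top)
  simpa [toReal_gaussianPDF] using this

lemma tendsto_mul_gaussianPDFReal_of_lipschitz {v : ℝ≥0} (hv : v ≠ 0) {K : ℝ≥0} {h : ℝ → ℝ}
    (hh : LipschitzWith K h) : Tendsto (fun t => h t * gaussianPDFReal 0 v t) atTop (𝓝 0) := by
  have hb : ∀ᶠ t in atTop, ‖h t * gaussianPDFReal 0 v t‖
      ≤ (|h 0| + K) * (t * gaussianPDFReal 0 v t) := by
    filter_upwards [eventually_ge_atTop 1] with t ht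
    have h1 : |h t - h 0| ≤ K * |t| := by simpa [Real.norm_eq_abs] using hh.norm_sub_le t 0
    rw [abs_of_nonneg (show 0 ≤ t by linarith)] at h1
    have h2 : |h t| ≤ |h 0| + K * t := by
      calc |h t| = |h t - h 0 + h 0| := by ring_nf
        _ ≤ |h t - h 0| + |h 0| := abs_add_le _ _
        _ ≤ _ := by linarith
    have h3 : |h t| ≤ (|h 0| + K) * t := by nlinarith [abs_nonneg (h 0)]
    rw [norm_mul, Real.norm_eq_abs, Real.norm_of_nonneg (gaussianPDFReal_nonneg _ _ _), ← mul_assoc]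
    exact mul_le_mul_of_nonneg_right h3 (gaussianPDFReal_nonneg _ _ _)
  refine squeeze_zero_norm' hb ?_
  simpa using (tendsto_id_mul_gaussianPDFReal hv).const_mul (|h 0| + K)

lemma integrable_mul_id_gaussianReal {h : ℝ → ℝ} {K : ℝ≥0} (hh : LipschitzWith K h) (v : ℝ≥0) :
    Integrable (fun t => h t * t) (gaussianReal 0 v) := by
  have hm : MemLp id (2 : ℝ≥0∞) (gaussianReal 0 v) := by exact_mod_cast memLp_id_gaussianReal 2
  exact (hh.memLp_of_memLp_id hm).integrable_mul hm

/-- Stein's identity for Lipschitz functions of a centred real Gaussian variable. -/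
lemma integral_mul_gaussianReal_eq_integral_deriv {h : ℝ → ℝ} {K : ℝ≥0} (hh : LipschitzWith K h)
    {v : ℝ≥0} (hv : v ≠ 0) :
    ∫ t, h t * t ∂(gaussianReal 0 v) = v * ∫ t, deriv h t ∂(gaussianReal 0 v) := by
  have hv' : (v : ℝ) ≠ 0 := by exact_mod_cast hv
  set g := gaussianPDFReal 0 v with hg
  have hdg : deriv g = fun t => -(t / v) * g t :=
    funext fun t => (hasDerivAt_gaussianPDFReal v t).deriv
  have hgc : ContDiff ℝ 1 g := by
    rw [hg, gaussianPDFReal_def]; fun_prop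
  have i1 : Integrable (fun t => h t * deriv g t) := by
    have := ((integrable_gaussianReal_iff hv).1 (integrable_mul_id_gaussianReal hh v)).const_mul
      (-(v : ℝ)⁻¹)
    refine this.congr (Eventually.of_forall fun t => ?_)
    simp only [hdg]; ring
  have i2 : Integrable (fun t => deriv h t * g t) := by
    refine (integrable_gaussianReal_iff hv).1 ?_
    exact Integrable.of_bound (measurable_deriv h).aestronglyMeasurable K
      (Eventually.of_forall fun t => norm_deriv_le_of_lipschitz hh)
  -- A Lipschitz function is absolutely continuous on bounded intervals, which is enough to
  -- integrate by parts against the density `g`, where `g' = -(t/v) g`.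
  have hparts : ∀ R : ℝ, ∫ t in (-R)..R, h t * deriv g t
      = h R * g R - h (-R) * g (-R) - ∫ t in (-R)..R, deriv h t * g t := fun R =>
    AbsolutelyContinuousOnInterval.integral_mul_deriv_eq_deriv_mul
      (hh.lipschitzOnWith.absolutelyContinuousOnInterval)
      (hgc.contDiffOn.absolutelyContinuousOnInterval)
  have t1 := intervalIntegral_tendsto_integral i1 tendsto_neg_atTop_atBot tendsto_id
  have t2 := intervalIntegral_tendsto_integral i2 tendsto_neg_atTop_atBot tendsto_id
  have t3 := tendsto_mul_gaussianPDFReal_of_lipschitz hv hh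
  -- The density is even, so the boundary term at `-R` is the term at `R` for the reflected
  -- function.
  have hh' : LipschitzWith K (fun t => h (-t)) := by
    refine LipschitzWith.of_dist_le_mul fun a b => ?_
    simpa using hh.dist_le_mul (-a) (-b)
  have t4 := tendsto_mul_gaussianPDFReal_of_lipschitz hv hh'
  have t5 := (t3.sub t4).sub t2
  have hlim : ∫ t, h t * deriv g t = 0 - 0 - ∫ t, deriv h t * g t := by
    refine tendsto_nhds_unique t1 (t5.congr fun R => ?_)
    have := hparts R
    rw [hg, gaussianPDFReal_neg_arg] at this
    simp only [id]
    exact this.symm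
  rw [integral_gaussianReal_eq_integral_smul hv, integral_gaussianReal_eq_integral_smul hv]
  have e1 : ∫ t, h t * deriv g t = -(v : ℝ)⁻¹ * ∫ t, g t • (h t * t) := by
    rw [← integral_const_mul]
    refine integral_congr_ae (Eventually.of_forall fun t => ?_)
    simp only [hdg, smul_eq_mul]; ring
  have e2 : ∫ t, deriv h t * g t = ∫ t, g t • deriv h t := by
    simp only [smul_eq_mul, mul_comm]
  rw [e1, e2] at hlim
  field_simp at hlim
  linarith

/-- For convex `h`, the tangent line inequality averaged against a Gaussian. -/
lemma ConvexOn.integral_sub_le_integral_mul_gaussianReal {h : ℝ → ℝ} {K : ℝ≥0}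
    (hc : ConvexOn ℝ Set.univ h) (hh : LipschitzWith K h) {v : ℝ≥0} (hv : v ≠ 0) (a : ℝ) :
    v * ∫ t, (h t - h (t - a)) ∂(gaussianReal 0 v) ≤ a * ∫ t, h t * t ∂(gaussianReal 0 v) := by
  have hd : ∀ᵐ t ∂(gaussianReal 0 v), DifferentiableAt ℝ h t :=
    (gaussianReal_absolutelyContinuous 0 hv).ae_le hh.ae_differentiableAt_real
  rw [integral_mul_gaussianReal_eq_integral_deriv hh hv, mul_left_comm]
  refine mul_le_mul_of_nonneg_left ?_ v.2
  rw [← integral_const_mul]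
  refine integral_mono_ae ?_ ?_ ?_
  · have hm : MemLp id 1 (gaussianReal 0 v) := by exact_mod_cast memLp_id_gaussianReal 1
    refine (memLp_one_iff_integrable.1 (hh.memLp_of_memLp_id hm)).sub
      (memLp_one_iff_integrable.1 (LipschitzWith.memLp_of_memLp_id (K := K) hm ?_))
    refine LipschitzWith.of_dist_le_mul fun x y => ?_
    simpa using hh.dist_le_mul (x - a) (y - a)
  · refine Integrable.const_mul ?_ a
    exact Integrable.of_bound (measurable_deriv h).aestronglyMeasurable K
      (Eventually.of_forall fun t => norm_deriv_le_of_lipschitz hh)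
  -- Pointwise `h t - h (t - a) ≤ a * h' t` wherever the derivative exists; the slope inequality is
  -- read on the left or the right of `t` according to the sign of `a`.
  · filter_upwards [hd] with t ht
    rcases lt_trichotomy a 0 with ha | ha | ha
    · have := hc.deriv_le_slope (Set.mem_univ t) (Set.mem_univ (t - a)) (by linarith) ht
      rw [slope_def_field, le_div_iff₀ (by linarith)] at this
      linarith
    · simp [ha]
    · have := hc.slope_le_deriv (Set.mem_univ (t - a)) (Set.mem_univ t) (by linarith) ht
      rw [slope_def_field, div_le_iff₀ (by linarith)] at this
      linarith

/-! ### Exponential radii against Gaussian weights. -/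

lemma integral_expMeasure_one (g : ℝ → ℝ) :
    ∫ v, g v ∂(expMeasure 1) = ∫ v in Set.Ioi 0, Real.exp (-v) * g v := by
  rw [expMeasure, gammaMeasure, show gammaPDF 1 1 = fun x => ENNReal.ofReal (gammaPDFReal 1 1 x) from rfl, integral_withDensity_eq_integral_toReal_smul
    (measurable_gammaPDFReal 1 1).ennreal_ofReal (Eventually.of_forall fun x => by simp),
    ← integral_Ici_eq_integral_Ioi, ← integral_indicator measurableSet_Ici]
  refine integral_congr_ae (Eventually.of_forall fun v => ?_)
  by_cases hv : 0 ≤ v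
  · simp [gammaPDFReal, hv, (Real.exp_pos _).le]
  · simp [gammaPDFReal, hv]

lemma lintegral_expMeasure_one_id : ∫⁻ v, ENNReal.ofReal v ∂(expMeasure 1) = 1 := by
  have h1 := Real.Gamma_eq_integral (s := 2) (by norm_num)
  have h2 := Real.GammaIntegral_convergent (s := 2) (by norm_num)
  norm_num at h1 h2
  rw [expMeasure, gammaMeasure, show gammaPDF 1 1 = fun x => ENNReal.ofReal (gammaPDFReal 1 1 x) from rfl, lintegral_withDensity_eq_lintegral_mul _
    (measurable_gammaPDFReal 1 1).ennreal_ofReal (by fun_prop)]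
  have h3 : ∀ v, ((fun x => ENNReal.ofReal (gammaPDFReal 1 1 x)) * fun v => ENNReal.ofReal v) v
      = (Set.Ioi (0 : ℝ)).indicator (fun v => ENNReal.ofReal (Real.exp (-v) * v)) v := by
    intro v
    by_cases hv : 0 < v
    · simp [gammaPDFReal, hv, hv.le, ENNReal.ofReal_mul (Real.exp_pos _).le]
    · simp [hv, ENNReal.ofReal_of_nonpos (not_lt.1 hv)]
  rw [lintegral_congr h3, lintegral_indicator measurableSet_Ioi,
    ← ofReal_integral_eq_lintegral_ofReal h2, ← h1]
  · simp
  · filter_upwards [ae_restrict_mem measurableSet_Ioi] with v hv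
    exact mul_nonneg (Real.exp_pos _).le (le_of_lt hv)

/-- The Box–Muller-type identity: an exponential radius with a random sign integrates a
one-dimensional function against `t` times a Gaussian density. -/
lemma integral_expMeasure_sub_eq_integral_gaussianReal {H : ℝ → ℝ} {K : ℝ≥0}
    (hH : LipschitzWith K H) {η : ℝ} (hη : 0 < η) :
    ∫ v, (H (η * √(2 * v)) - H (-(η * √(2 * v)))) ∂(expMeasure 1)
      = √(2 * Real.pi) / η * ∫ t, H t * t ∂(gaussianReal 0 (η ^ 2).toNNReal) := by
  set D : ℝ → ℝ := fun t => H t - H (-t)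
  set q : ℝ≥0 := (η ^ 2).toNNReal
  have hqv : (q : ℝ) = η ^ 2 := Real.coe_toNNReal _ (sq_nonneg η)
  have hq : q ≠ 0 := by simpa [q] using hη.ne'
  have hI := (integrable_gaussianReal_iff hq).1 (integrable_mul_id_gaussianReal hH q)
  have hpdf : ∀ t, gaussianPDFReal 0 q t
      = (√(2 * Real.pi) * η)⁻¹ * Real.exp (-t ^ 2 / (2 * η ^ 2)) := by
    intro t
    rw [gaussianPDFReal_def]
    have : √(2 * Real.pi * q) = √(2 * Real.pi) * η := by
      rw [hqv, Real.sqrt_mul (by positivity), Real.sqrt_sq hη.le]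
    rw [this]; simp only [hqv, sub_zero]
  -- Folding the line at the origin: `t` is odd and the density even, so only the odd difference `D`
  -- of `H` survives.
  have hR : ∫ t, H t * t ∂(gaussianReal 0 q)
      = ∫ t in Set.Ioi 0, D t * t * gaussianPDFReal 0 q t := by
    rw [integral_gaussianReal_eq_integral_smul hq]
    have e1 : ∫ t, gaussianPDFReal 0 q t • (H t * t) = ∫ t, H t * t * gaussianPDFReal 0 q t := by
      simp only [smul_eq_mul, mul_comm]
    rw [e1, ← intervalIntegral.integral_Iic_add_Ioi (b := 0) hI.integrableOn hI.integrableOn]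
    have e2 := integral_comp_neg_Ioi (0 : ℝ) (fun t => H t * t * gaussianPDFReal 0 q t)
    rw [neg_zero] at e2
    have i2 : IntegrableOn (fun t => H (-t) * -t * gaussianPDFReal 0 q (-t)) (Set.Ioi 0) :=
      hI.comp_neg.integrableOn
    rw [← e2, ← integral_add i2 hI.integrableOn]
    refine integral_congr_ae (Eventually.of_forall fun t => ?_)
    simp only [D, gaussianPDFReal_neg_arg]; ring
  -- Two substitutions, `v = r²` and then `t = η√2 r`, turn `exp(-v) dv` into `(t/η²) exp(-t²/(2η²))
  -- dt`.
  have e3 := integral_comp_rpow_Ioi (fun v => Real.exp (-v) * D (η * √(2 * v))) (p := 2) two_ne_zero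
  have e4 := integral_comp_mul_left_Ioi
    (fun t => (√2 / η) * (D t * t * Real.exp (-t ^ 2 / (2 * η ^ 2)))) 0
    (b := η * √2) (by positivity)
  have e5 : ∫ v, D (η * √(2 * v)) ∂(expMeasure 1)
      = (η * √2)⁻¹ * ((√2 / η) * ∫ t in Set.Ioi 0, D t * t * Real.exp (-t ^ 2 / (2 * η ^ 2))) := by
    rw [integral_expMeasure_one, ← e3, ← integral_const_mul, ← smul_eq_mul]
    rw [mul_zero] at e4
    rw [← e4]
    refine setIntegral_congr_fun measurableSet_Ioi fun t (ht : 0 < t) => ?_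
    have h1 : √(2 * t ^ 2) = √2 * t := by
      rw [Real.sqrt_mul (by norm_num), Real.sqrt_sq ht.le]
    have h2 : -(η * √2 * t) ^ 2 / (2 * η ^ 2) = -t ^ 2 := by
      rw [mul_pow, mul_pow, Real.sq_sqrt (by norm_num)]; field_simp
    have h3 : (t : ℝ) ^ ((2 : ℝ) - 1) = t := by norm_num
    simp only [h2]
    simp only [smul_eq_mul, h3, Real.rpow_two, h1, abs_of_pos (zero_lt_two' ℝ), mul_assoc]
    have h4 : √2 / η * (D (η * (√2 * t)) * (η * (√2 * (t * Real.exp (-t ^ 2)))))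
        = (√2 * √2) * (D (η * (√2 * t)) * (t * Real.exp (-t ^ 2))) := by
      field_simp
    rw [h4, Real.mul_self_sqrt (by norm_num)]; ring
  change ∫ v, D (η * √(2 * v)) ∂(expMeasure 1) = _
  rw [e5, hR, ← integral_const_mul, ← integral_const_mul, ← integral_const_mul]
  refine integral_congr_ae (Eventually.of_forall fun t => ?_)
  simp only [hpdf]
  have : √(2 * Real.pi) ≠ 0 := by positivity
  field_simp

lemma sq_integral_le_integral_sq {α : Type*} [MeasurableSpace α] {ρ : Measure α}
    [IsProbabilityMeasure ρ] {g : α → ℝ} (hg : MemLp g 2 ρ) :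
    (∫ a, g a ∂ρ) ^ 2 ≤ ∫ a, g a ^ 2 ∂ρ := by
  have h1 := variance_eq_sub hg
  have h2 := variance_nonneg g ρ
  simp only [Pi.pow_apply] at h1
  linarith

/-! ### Isotropic Gaussian vectors and Gaussian smoothing. -/

section Gaussian

variable {n : ℕ}

lemma posSemidef_sq_smul_one (η : ℝ) :
    (η ^ 2 • (1 : Matrix (Fin n) (Fin n) ℝ)).PosSemidef :=
  Matrix.PosSemidef.one.smul (sq_nonneg η)

/-- The centred isotropic Gaussian law `𝒩(0, η² I)` on `ℝⁿ`. -/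
noncomputable abbrev isoGaussian (n : ℕ) (η : ℝ) : Measure (EuclideanSpace ℝ (Fin n)) :=
  multivariateGaussian 0 (η ^ 2 • (1 : Matrix (Fin n) (Fin n) ℝ))

lemma charFun_isoGaussian (η : ℝ) (t : EuclideanSpace ℝ (Fin n)) :
    charFun (isoGaussian n η) t = Complex.exp (-(η ^ 2 * ‖t‖ ^ 2 / 2 : ℝ)) := by
  rw [charFun_multivariateGaussian (posSemidef_sq_smul_one η)]
  congr 1
  have : t.ofLp ⬝ᵥ t.ofLp = ‖t‖ ^ 2 := by
    rw [EuclideanSpace.real_norm_sq_eq]; simp [dotProduct, sq]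
  rw [Matrix.smul_mulVec, Matrix.one_mulVec, dotProduct_smul, this]
  simp

/-- Replacing the component of a Gaussian vector along a unit vector by an independent Gaussian
variable, and reflecting the other components, does not change its law. -/
lemma map_resample_isoGaussian (η : ℝ) {u : EuclideanSpace ℝ (Fin n)} (hu : ‖u‖ = 1) :
    ((isoGaussian n η).prod (gaussianReal 0 (η ^ 2).toNNReal)).map
      (fun p => -p.1 + (⟪u, p.1⟫ + p.2) • u) = isoGaussian n η := by
  have hm : Measurable (fun p : EuclideanSpace ℝ (Fin n) × ℝ => -p.1 + (⟪u, p.1⟫ + p.2) • u) := by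
    fun_prop
  have := Measure.isProbabilityMeasure_map
    (μ := (isoGaussian n η).prod (gaussianReal 0 (η ^ 2).toNNReal)) hm.aemeasurable
  refine Measure.ext_of_charFun (funext fun t => ?_)
  rw [charFun_apply, integral_map hm.aemeasurable (by fun_prop)]
  -- In the characteristic function `z` meets `-t + ⟪u, t⟫ u`, of squared norm `‖t‖² - ⟪u, t⟫²`, and
  -- the new variable meets `⟪u, t⟫`; the squares add up to `‖t‖²`.
  have h1 : ∀ p : EuclideanSpace ℝ (Fin n) × ℝ,
      Complex.exp (⟪-p.1 + (⟪u, p.1⟫ + p.2) • u, t⟫ * Complex.I)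
      = Complex.exp (⟪p.1, -t + ⟪u, t⟫ • u⟫ * Complex.I)
        * Complex.exp (⟪p.2, ⟪u, t⟫⟫ * Complex.I) := by
    intro p
    rw [← Complex.exp_add, ← add_mul, ← Complex.ofReal_add]
    congr 3
    simp only [inner_add_left, inner_add_right, inner_neg_left, inner_neg_right, inner_smul_left,
      inner_smul_right, real_inner_comm u p.1]
    simp
    ring
  simp_rw [h1]
  rw [integral_prod_mul (fun z => Complex.exp (⟪z, -t + ⟪u, t⟫ • u⟫ * Complex.I))
    (fun τ : ℝ => Complex.exp (⟪τ, ⟪u, t⟫⟫ * Complex.I)), ← charFun_apply, ← charFun_apply,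
    charFun_gaussianReal, charFun_isoGaussian, charFun_isoGaussian, ← Complex.exp_add]
  congr 1
  have h2 : ‖-t + ⟪u, t⟫ • u‖ ^ 2 = ‖t‖ ^ 2 - ⟪u, t⟫ ^ 2 := by
    rw [norm_add_sq_real, norm_smul, hu, norm_neg, inner_neg_left, inner_smul_right,
      real_inner_comm, Real.norm_eq_abs, mul_one, sq_abs]
    ring
  rw [h2]
  rw [Real.coe_toNNReal _ (sq_nonneg η)]
  push_cast
  ring

lemma memLp_id_isoGaussian (η : ℝ) : MemLp id 2 (isoGaussian n η) :=
  IsGaussian.memLp_id _ 2 (by simp)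

/-- Jensen: the mean norm is at most the root of the second moment `n η²`. This is the source of the
smoothing bias `L₀ η √n`. -/
lemma integral_norm_isoGaussian_le {η : ℝ} (hη : 0 ≤ η) :
    ∫ w, ‖w‖ ∂(isoGaussian n η) ≤ η * √n := by
  have h1 : ∫ w, ‖w‖ ^ 2 ∂(isoGaussian n η) = n * η ^ 2 := by
    have hi : ∀ i : Fin n, Integrable (fun w : EuclideanSpace ℝ (Fin n) => w i ^ 2)
        (isoGaussian n η) := fun i => by
      have : MemLp (fun w : EuclideanSpace ℝ (Fin n) => w i) 2 (isoGaussian n η) :=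
        (memLp_id_isoGaussian η).of_le (by fun_prop)
          (Eventually.of_forall fun w => PiLp.norm_apply_le w i)
      exact this.integrable_sq
    simp_rw [EuclideanSpace.real_norm_sq_eq]
    rw [integral_finsetSum _ fun i _ => hi i]
    have hv : ∀ i : Fin n, ∫ w, w i ^ 2 ∂(isoGaussian n η) = η ^ 2 := fun i => by
      have h := variance_eval_multivariateGaussian (μ := 0) (posSemidef_sq_smul_one (n := n) η) i
      have h0 : ∫ w, w i ∂(isoGaussian n η) = 0 := by
        have hp := measurePreserving_eval_multivariateGaussian (μ := 0)
          (posSemidef_sq_smul_one (n := n) η) (i := i)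
        rw [← integral_map (f := fun t : ℝ => t) (φ := fun w : EuclideanSpace ℝ (Fin n) => w i)
          (by fun_prop) (by fun_prop), hp.map_eq, integral_id_gaussianReal]
        simp
      rw [← variance_of_integral_eq_zero (by fun_prop) h0, h]
      simp
    simp [hv]
  have h2 := sq_integral_le_integral_sq (memLp_id_isoGaussian (n := n) η).norm
  simp only [id] at h2
  rw [h1] at h2
  have h3 := Real.abs_le_sqrt h2
  calc _ ≤ _ := (le_abs_self _).trans h3
    _ = η * √n := by rw [Real.sqrt_mul (by positivity), Real.sqrt_sq hη, mul_comm]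

/-- Jensen for a centred perturbation: smoothing can only raise a convex function, so the bias has
to be paid at the comparison point `y` alone and not at `x`. -/
lemma ConvexOn.le_integral_add_isoGaussian {f : EuclideanSpace ℝ (Fin n) → ℝ} {K : ℝ≥0}
    (hf : ConvexOn ℝ Set.univ f) (hK : LipschitzWith K f) (η : ℝ) (x : EuclideanSpace ℝ (Fin n)) :
    f x ≤ ∫ w, f (x + w) ∂(isoGaussian n η) := by
  have hi : Integrable (fun w => x + w) (isoGaussian n η) :=
    (integrable_const x).add IsGaussian.integrable_id
  have h := hf.map_integral_le (μ := isoGaussian n η) (f := fun w => x + w)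
    hK.continuous.continuousOn isClosed_univ (by simp) hi
    (memLp_one_iff_integrable.1 ((hK.comp (LipschitzWith.of_dist_le_mul (K := 1)
      fun a b => by simp)).memLp_of_memLp_id (memLp_one_iff_integrable.2 IsGaussian.integrable_id)))
  rwa [integral_add (integrable_const x) IsGaussian.integrable_fun_id,
    integral_id_multivariateGaussian, integral_const, probReal_univ, one_smul, add_zero] at h

lemma LipschitzWith.integral_add_isoGaussian_le {f : EuclideanSpace ℝ (Fin n) → ℝ} {K : ℝ≥0}
    (hK : LipschitzWith K f) {η : ℝ} (hη : 0 ≤ η) (x : EuclideanSpace ℝ (Fin n)) :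
    ∫ w, f (x + w) ∂(isoGaussian n η) ≤ f x + K * (η * √n) := by
  have hn : Integrable (fun w => ‖w‖) (isoGaussian n η) := IsGaussian.integrable_fun_id.norm
  calc ∫ w, f (x + w) ∂(isoGaussian n η) ≤ ∫ w, (f x + K * ‖w‖) ∂(isoGaussian n η) := by
        refine integral_mono ?_ ((integrable_const _).add (hn.const_mul _)) fun w => ?_
        · exact memLp_one_iff_integrable.1 ((hK.comp (LipschitzWith.of_dist_le_mul (K := 1)
            (f := fun w => x + w) fun a b => by simp)).memLp_of_memLp_id
            (memLp_one_iff_integrable.2 IsGaussian.integrable_id))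
        · have := hK.norm_sub_le (x + w) x
          rw [add_sub_cancel_left] at this
          have := (le_abs_self _).trans this
          simp only; linarith
    _ = f x + K * ∫ w, ‖w‖ ∂(isoGaussian n η) := by
        rw [integral_add (integrable_const _) (hn.const_mul _), integral_const_mul]
        simp
    _ ≤ _ := by gcongr; exact integral_norm_isoGaussian_le hη

lemma integrable_comp_resample_isoGaussian (η : ℝ) {u : EuclideanSpace ℝ (Fin n)}
    (hu : ‖u‖ = 1) {g : EuclideanSpace ℝ (Fin n) → ℝ} (hg : Integrable g (isoGaussian n η)) :
    Integrable (fun p : EuclideanSpace ℝ (Fin n) × ℝ => g (-p.1 + (⟪u, p.1⟫ + p.2) • u))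
      ((isoGaussian n η).prod (gaussianReal 0 (η ^ 2).toNNReal)) := by
  have hm : Measurable (fun p : EuclideanSpace ℝ (Fin n) × ℝ => -p.1 + (⟪u, p.1⟫ + p.2) • u) := by
    fun_prop
  rw [← map_resample_isoGaussian η hu] at hg
  exact (integrable_map_measure hg.1 hm.aemeasurable).1 hg

/-- Expectations under an isotropic Gaussian law, split along a unit direction. -/
lemma integral_isoGaussian_eq_integral_integral (η : ℝ) {u : EuclideanSpace ℝ (Fin n)}
    (hu : ‖u‖ = 1) {g : EuclideanSpace ℝ (Fin n) → ℝ} (hg : Integrable g (isoGaussian n η)) :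
    ∫ w, g w ∂(isoGaussian n η) = ∫ z, ∫ t, g (-z + (⟪u, z⟫ + t) • u)
      ∂(gaussianReal 0 (η ^ 2).toNNReal) ∂(isoGaussian n η) := by
  have hm : Measurable (fun p : EuclideanSpace ℝ (Fin n) × ℝ => -p.1 + (⟪u, p.1⟫ + p.2) • u) := by
    fun_prop
  have h := map_resample_isoGaussian η hu
  have hi := integrable_comp_resample_isoGaussian η hu hg
  rw [← h] at hg
  rw [← integral_prod (fun p : EuclideanSpace ℝ (Fin n) × ℝ => g (-p.1 + (⟪u, p.1⟫ + p.2) • u)) hi,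
    ← integral_map hm.aemeasurable hg.1, h]

lemma LipschitzWith.integrable_mul_inner_isoGaussian {f : EuclideanSpace ℝ (Fin n) → ℝ} {K : ℝ≥0}
    (hK : LipschitzWith K f) (η : ℝ) (u : EuclideanSpace ℝ (Fin n)) :
    Integrable (fun w => f w * ⟪u, w⟫) (isoGaussian n η) := by
  refine (hK.memLp_of_memLp_id (memLp_id_isoGaussian η)).integrable_mul (q := 2) ?_
  exact (memLp_id_isoGaussian η).of_le_mul (c := ‖u‖) (by fun_prop)
    (Eventually.of_forall fun w => norm_inner_le_norm u w)

/-- The Gaussian gradient inequality: `E[f(x+w) ⟨x-y,w⟩]/η²` plays the role of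
`⟨∇f_η(x), x-y⟩` for the smoothed function `f_η`. -/
lemma ConvexOn.sub_le_integral_mul_inner_isoGaussian {f : EuclideanSpace ℝ (Fin n) → ℝ} {K : ℝ≥0}
    (hf : ConvexOn ℝ Set.univ f) (hK : LipschitzWith K f) {η : ℝ} (hη : 0 < η)
    (x y : EuclideanSpace ℝ (Fin n)) :
    f x - f y - K * (η * √n) ≤ (η ^ 2)⁻¹ * ∫ w, f (x + w) * ⟪x - y, w⟫ ∂(isoGaussian n η) := by
  have hshift : ∀ a : EuclideanSpace ℝ (Fin n), LipschitzWith K (fun w => f (a + w)) := fun a =>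
    LipschitzWith.of_dist_le_mul fun v w => by simpa using hK.dist_le_mul (a + v) (a + w)
  have hint : ∀ a : EuclideanSpace ℝ (Fin n), Integrable (fun w => f (a + w)) (isoGaussian n η) :=
    fun a => memLp_one_iff_integrable.1 ((hshift a).memLp_of_memLp_id
      (memLp_one_iff_integrable.2 IsGaussian.integrable_id))
  have hbase : f x - f y - K * (η * √n)
      ≤ ∫ w, (f (x + w) - f (y + w)) ∂(isoGaussian n η) := by
    rw [integral_sub (hint x) (hint y)]
    have h1 := hf.le_integral_add_isoGaussian hK η x
    have h2 := hK.integral_add_isoGaussian_le hη.le y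
    linarith
  refine hbase.trans ?_
  rcases eq_or_ne x y with rfl | hxy
  · simp
  set r := ‖x - y‖ with hr
  have hr0 : 0 < r := norm_pos_iff.2 (sub_ne_zero.2 hxy)
  set u : EuclideanSpace ℝ (Fin n) := r⁻¹ • (x - y) with hu
  have hu1 : ‖u‖ = 1 := by
    rw [hu, norm_smul, norm_inv, Real.norm_of_nonneg hr0.le, ← hr, inv_mul_cancel₀ hr0.ne']
  have hru : x - y = r • u := by rw [hu, smul_smul, mul_inv_cancel₀ hr0.ne', one_smul]
  have hqv : ((η ^ 2).toNNReal : ℝ) = η ^ 2 := Real.coe_toNNReal _ (sq_nonneg η)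
  have hq : (η ^ 2).toNNReal ≠ 0 := by simpa using hη.ne'
  have hi1 : Integrable (fun w => f (x + w) - f (y + w)) (isoGaussian n η) :=
    (hint x).sub (hint y)
  have hi2 : Integrable (fun w => (η ^ 2)⁻¹ * (f (x + w) * ⟪x - y, w⟫)) (isoGaussian n η) :=
    ((hshift x).integrable_mul_inner_isoGaussian η (x - y)).const_mul _
  rw [← integral_const_mul, integral_isoGaussian_eq_integral_integral η hu1 hi1,
    integral_isoGaussian_eq_integral_integral η hu1 hi2]
  -- With both expectations split along `u`, it suffices to compare them on each line parallel to `x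
  -- - y`, where moving from `x` to `y` is a shift of the parameter by `r`.
  refine integral_mono (integrable_comp_resample_isoGaussian η hu1 hi1).integral_prod_left 
    (integrable_comp_resample_isoGaussian η hu1 hi2).integral_prod_left fun z => ?_
  set h : ℝ → ℝ := fun t => f (x + (-z + (⟪u, z⟫ + t) • u)) with hh
  have hhc : ConvexOn ℝ Set.univ h := by
    refine ⟨convex_univ, fun a _ b _ α β hα hβ hαβ => ?_⟩
    have := hf.2 (Set.mem_univ (x + (-z + (⟪u, z⟫ + a) • u)))
      (Set.mem_univ (x + (-z + (⟪u, z⟫ + b) • u))) hα hβ hαβ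
    refine le_of_eq_of_le ?_ this
    simp only [hh]
    congr 1
    obtain rfl : β = 1 - α := by linarith
    simp only [smul_eq_mul]
    module
  have hhK : LipschitzWith K h := by
    refine LipschitzWith.of_dist_le_mul fun a b => ?_
    refine (hK.dist_le_mul _ _).trans_eq ?_
    congr 1
    rw [dist_eq_norm, dist_eq_norm]
    have : x + (-z + (⟪u, z⟫ + a) • u) - (x + (-z + (⟪u, z⟫ + b) • u)) = (a - b) • u := by module
    rw [this, norm_smul, hu1, mul_one]
  have key := hhc.integral_sub_le_integral_mul_gaussianReal hhK hq r
  rw [hqv] at key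
  have e1 : ∀ t, f (x + (-z + (⟪u, z⟫ + t) • u)) - f (y + (-z + (⟪u, z⟫ + t) • u))
      = h t - h (t - r) := fun t => by
    simp only [hh]
    congr 2
    have : y = x - r • u := by rw [← hru]; abel
    rw [this]; module
  have e2 : ∀ t, (η ^ 2)⁻¹ * (f (x + (-z + (⟪u, z⟫ + t) • u)) * ⟪x - y, -z + (⟪u, z⟫ + t) • u⟫)
      = (η ^ 2)⁻¹ * r * (h t * t) := fun t => by
    have : ⟪x - y, -z + (⟪u, z⟫ + t) • u⟫ = r * t := by
      rw [hru, inner_smul_left, inner_add_right, inner_neg_right, inner_smul_right,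
        real_inner_self_eq_norm_sq, hu1]
      simp
    rw [this]; simp only [hh]; ring
  simp only [e1, e2]
  rw [integral_const_mul, mul_assoc, ← div_eq_inv_mul, le_div_iff₀ (by positivity), mul_comm]
  exact key

end Gaussian

/-! ### Reduction of the three settings to mean-square Lipschitz continuity. -/

lemma eLpNorm_two_le_ofReal_iff {α : Type*} [MeasurableSpace α] {ρ : Measure α} {g : α → ℝ}
    {c : ℝ} (hc : 0 ≤ c) :
    eLpNorm g 2 ρ ≤ ENNReal.ofReal c ↔ ∫⁻ a, ENNReal.ofReal (g a ^ 2) ∂ρ ≤ ENNReal.ofReal (c ^ 2) := by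
  have h1 : ∀ a, ‖g a‖ₑ ^ (2 : ℝ) = ENNReal.ofReal (g a ^ 2) := fun a => by
    rw [← ofReal_norm, ENNReal.ofReal_rpow_of_nonneg (norm_nonneg _) (by norm_num)]
    simp
  rw [eLpNorm_eq_lintegral_rpow_enorm_toReal (by norm_num) (by norm_num)]
  simp only [ENNReal.toReal_ofNat, h1]
  rw [ENNReal.ofReal_pow hc, one_div, ENNReal.rpow_inv_le_iff (by norm_num)]
  norm_num

/-- `Φ` is a random function with mean `f` that is `L₀`-Lipschitz in mean square, and `f` is
convex. -/
structure MeanSquareLipschitz {n : ℕ} {S : Type*} [MeasurableSpace S] (P : Measure S)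
    (Φ : EuclideanSpace ℝ (Fin n) → S → ℝ) (f : EuclideanSpace ℝ (Fin n) → ℝ) (L₀ : ℝ) :
    Prop where
  measurable : Measurable (Function.uncurry Φ)
  integrable : ∀ x, Integrable (Φ x) P
  f_eq : ∀ x, f x = ∫ s, Φ x s ∂P
  lipschitz : ∀ x y,
    ∫⁻ s, ENNReal.ofReal ((Φ x s - Φ y s) ^ 2) ∂P ≤ ENNReal.ofReal ((L₀ * ‖x - y‖) ^ 2)
  convex : ConvexOn ℝ Set.univ f

section Settings

variable {n : ℕ} {S : Type*} [MeasurableSpace S]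

lemma StandardSetting.meanSquareLipschitz {P : Measure S} {F : EuclideanSpace ℝ (Fin n) → S → ℝ}
    {f : EuclideanSpace ℝ (Fin n) → ℝ} {L₀ : ℝ} (hL : 0 ≤ L₀) (h : StandardSetting P F f L₀) :
    MeanSquareLipschitz P F f L₀ where
  measurable := h.measurable
  integrable := h.integrable
  f_eq := h.f_eq
  lipschitz x y := (eLpNorm_two_le_ofReal_iff (by positivity)).1 (h.lipschitz x y)
  convex := by
    refine ⟨convex_univ, fun x _ y _ a b ha hb hab => ?_⟩
    simp only [h.f_eq, smul_eq_mul]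
    rw [← integral_const_mul, ← integral_const_mul,
      ← integral_add ((h.integrable x).const_mul a) ((h.integrable y).const_mul b)]
    refine integral_mono_ae (h.integrable _)
      (((h.integrable x).const_mul a).add ((h.integrable y).const_mul b)) ?_
    filter_upwards [h.convex] with s hs
    exact hs.2 (Set.mem_univ x) (Set.mem_univ y) ha hb hab

lemma RandomFieldSetting.meanSquareLipschitz {d : ℕ} {P : Measure S}
    {ξ : EuclideanSpace ℝ (Fin n) → S → EuclideanSpace ℝ (Fin d)}
    {𝒟 : EuclideanSpace ℝ (Fin n) → Measure (EuclideanSpace ℝ (Fin d))}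
    {Fhat : EuclideanSpace ℝ (Fin n) → EuclideanSpace ℝ (Fin d) → ℝ}
    {f : EuclideanSpace ℝ (Fin n) → ℝ} {L₀ : ℝ} (hL : 0 ≤ L₀)
    (h : RandomFieldSetting P ξ 𝒟 Fhat f L₀) :
    MeanSquareLipschitz P (fun x s => Fhat x (ξ x s)) f L₀ where
  measurable := h.measurable_Fhat.comp (measurable_fst.prodMk h.measurable_ξ)
  integrable x := by
    have h1 := h.integrable x
    rw [← h.marginal x] at h1
    exact (integrable_map_measure h1.1 (h.measurable_ξ.of_uncurry_left).aemeasurable).1 h1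
  f_eq x := by
    have h1 := h.integrable x
    rw [h.f_eq, ← h.marginal x] at *
    exact integral_map (h.measurable_ξ.of_uncurry_left).aemeasurable h1.1
  lipschitz x y := (eLpNorm_two_le_ofReal_iff (by positivity)).1 (h.lipschitz x y)
  convex := h.convex

/-- The logarithmic mean is at most the maximum. -/
lemma sq_sub_le_mul_log_sub {a b m : ℝ} (ha : 0 < a) (hb : 0 < b) (ham : a ≤ m) (hbm : b ≤ m) :
    (a - b) ^ 2 ≤ m * (a * Real.log (a / b) + b * Real.log (b / a)) := by
  -- For `b ≤ a` the bracket is `(a - b) log(a/b)`, and `log(a/b) ≥ 1 - b/a` makes `a log(a/b)` at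
  -- least `a - b`. The other case is symmetric.
  have key : ∀ {a b : ℝ}, 0 < a → 0 < b → a ≤ m → b ≤ a →
      (a - b) ^ 2 ≤ m * (a * Real.log (a / b) + b * Real.log (b / a)) := by
    intro a b ha hb ham hba
    have h1 : 1 - b / a ≤ Real.log (a / b) := by
      have := Real.one_sub_inv_le_log_of_pos (div_pos ha hb)
      rwa [inv_div] at this
    have h2 : Real.log (b / a) = - Real.log (a / b) := by rw [← Real.log_inv, inv_div]
    have h3 : a - b ≤ a * Real.log (a / b) := by
      have := mul_le_mul_of_nonneg_left h1 ha.le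
      rwa [mul_sub, mul_one, mul_div_cancel₀ _ ha.ne'] at this
    have h4 : 0 ≤ Real.log (a / b) := Real.log_nonneg (by rwa [le_div_iff₀ hb, one_mul])
    rw [h2]
    have h5 : (a - b) * (a - b) ≤ (a - b) * (a * Real.log (a / b)) :=
      mul_le_mul_of_nonneg_left h3 (by linarith)
    have h6 : a * ((a - b) * Real.log (a / b)) ≤ m * ((a - b) * Real.log (a / b)) :=
      mul_le_mul_of_nonneg_right ham (mul_nonneg (by linarith) h4)
    nlinarith
  rcases le_total b a with h | h
  · exact key ha hb ham h
  · have := key hb ha hbm h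
    nlinarith

/-! ### Kullback–Leibler divergence in terms of densities. -/

section Densities

variable {ν : Measure S} {a b : S → ℝ}

lemma ae_eq_zero_of_withDensity_absolutelyContinuous (ha : Measurable a) (hb : Measurable b)
    (ha0 : ∀ s, 0 ≤ a s)
    (h : (ν.withDensity fun s => ENNReal.ofReal (a s)) ≪ ν.withDensity fun s => ENNReal.ofReal (b s)) :
    ∀ᵐ s ∂ν, b s = 0 → a s = 0 := by
  have hB : MeasurableSet {s | b s = 0} := hb (measurableSet_singleton 0)
  have h1 : (ν.withDensity fun s => ENNReal.ofReal (b s)) {s | b s = 0} = 0 := by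
    rw [withDensity_apply _ hB, setLIntegral_congr_fun hB (g := fun _ => 0)]
    · simp
    · intro s hs
      have : b s = 0 := hs
      simp [this]
  have h2 := h h1
  rw [withDensity_apply _ hB, lintegral_eq_zero_iff ha.ennreal_ofReal] at h2
  filter_upwards [(ae_restrict_iff' hB).1 h2] with s hs hbs
  exact le_antisymm (ENNReal.ofReal_eq_zero.1 (hs hbs)) (ha0 s)

/-- Since `a` vanishes where `b` does, `a = b * (a / b)` almost everywhere despite division by zero,
so `a / b` is the Radon–Nikodym derivative. -/
lemma llr_withDensity_ae_eq [SigmaFinite ν] (ha : Measurable a) (hb : Measurable b)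
    (ha0 : ∀ s, 0 ≤ a s) (hb0 : ∀ s, 0 ≤ b s) (hab : ∀ᵐ s ∂ν, b s = 0 → a s = 0) :
    llr (ν.withDensity fun s => ENNReal.ofReal (a s)) (ν.withDensity fun s => ENNReal.ofReal (b s))
      =ᵐ[ν.withDensity fun s => ENNReal.ofReal (b s)] fun s => Real.log (a s / b s) := by
  have : SigmaFinite (ν.withDensity fun s => ENNReal.ofReal (b s)) :=
    SigmaFinite.withDensity_of_ne_top (Eventually.of_forall fun s => ENNReal.ofReal_ne_top)
  have hm : Measurable fun s => ENNReal.ofReal (a s / b s) := by fun_prop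
  have h1 : (ν.withDensity fun s => ENNReal.ofReal (a s))
      = (ν.withDensity fun s => ENNReal.ofReal (b s)).withDensity
        fun s => ENNReal.ofReal (a s / b s) := by
    rw [← withDensity_mul _ hb.ennreal_ofReal hm]
    refine withDensity_congr_ae ?_
    filter_upwards [hab] with s hs
    rw [Pi.mul_apply, ← ENNReal.ofReal_mul (hb0 s)]
    congr 1
    by_cases hbs : b s = 0
    · simp [hbs, hs hbs]
    · field_simp
  have h2 := Measure.rnDeriv_withDensity (ν.withDensity fun s => ENNReal.ofReal (b s)) hm
  rw [h1]
  filter_upwards [h2] with s hs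
  rw [llr_def]
  simp only
  rw [hs, ENNReal.toReal_ofReal (div_nonneg (ha0 s) (hb0 s))]

/-- The Kullback–Leibler divergence between two laws given by probability densities. -/
lemma toReal_klDiv_withDensity [SigmaFinite ν] (ha : Measurable a) (hb : Measurable b)
    (ha0 : ∀ s, 0 ≤ a s) (hb0 : ∀ s, 0 ≤ b s) (ha1 : ∫⁻ s, ENNReal.ofReal (a s) ∂ν = 1)
    (hb1 : ∫⁻ s, ENNReal.ofReal (b s) ∂ν = 1)
    (h : InformationTheory.klDiv (ν.withDensity fun s => ENNReal.ofReal (a s))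
      (ν.withDensity fun s => ENNReal.ofReal (b s)) ≠ ∞) :
    (∀ᵐ s ∂ν, b s = 0 → a s = 0) ∧ Integrable (fun s => a s * Real.log (a s / b s)) ν ∧
      (InformationTheory.klDiv (ν.withDensity fun s => ENNReal.ofReal (a s))
        (ν.withDensity fun s => ENNReal.ofReal (b s))).toReal
      = ∫ s, a s * Real.log (a s / b s) ∂ν := by
  obtain ⟨hac, hint⟩ := InformationTheory.klDiv_ne_top_iff.1 h
  have hab := ae_eq_zero_of_withDensity_absolutelyContinuous ha hb ha0 hac
  have hfa : IsFiniteMeasure (ν.withDensity fun s => ENNReal.ofReal (a s)) :=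
    isFiniteMeasure_withDensity (by simp [ha1])
  have hfb : IsFiniteMeasure (ν.withDensity fun s => ENNReal.ofReal (b s)) :=
    isFiniteMeasure_withDensity (by simp [hb1])
  have hllr := hac.ae_le (llr_withDensity_ae_eq ha hb ha0 hb0 hab)
  refine ⟨hab, ?_, ?_⟩
  · have h1 := (integrable_congr hllr).1 hint
    rw [integrable_withDensity_iff ha.ennreal_ofReal
      (Eventually.of_forall fun s => ENNReal.ofReal_lt_top)] at h1
    refine h1.congr (Eventually.of_forall fun s => ?_)
    simp only [ENNReal.toReal_ofReal (ha0 s)]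
    ring
  -- The mass correction in `klDiv` cancels because both laws have total mass one.
  · rw [InformationTheory.toReal_klDiv_of_measure_eq hac
      (by simp [withDensity_apply, ha1, hb1]), integral_congr_ae hllr,
      integral_withDensity_eq_integral_toReal_smul ha.ennreal_ofReal
      (Eventually.of_forall fun s => ENNReal.ofReal_lt_top)]
    simp only [ENNReal.toReal_ofReal (ha0 _), smul_eq_mul]

end Densities

/-! ### Importance weighting by a fixed sampling density. -/

section KnownDensity

variable {ν : Measure S} {Ξ : EuclideanSpace ℝ (Fin n) → Set S}
  {p : EuclideanSpace ℝ (Fin n) → S → ℝ} {q : S → ℝ} {Fhat : EuclideanSpace ℝ (Fin n) → S → ℝ}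
  {f : EuclideanSpace ℝ (Fin n) → ℝ} {Lξ Lf M Mf : ℝ}

namespace KnownDensitySetting

lemma p_nonneg (h : KnownDensitySetting ν Ξ p q Fhat f Lξ Lf M Mf) (x : EuclideanSpace ℝ (Fin n))
    (s : S) : 0 ≤ p x s := by
  by_cases hs : s ∈ Ξ x
  · exact (h.p_pos x s hs).le
  · exact (h.p_eq_zero x s hs).ge

lemma p_ne_zero_iff (h : KnownDensitySetting ν Ξ p q Fhat f Lξ Lf M Mf)
    {x : EuclideanSpace ℝ (Fin n)} {s : S} : p x s ≠ 0 ↔ s ∈ Ξ x :=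
  ⟨fun hs => by_contra fun hn => hs (h.p_eq_zero x s hn), fun hs => (h.p_pos x s hs).ne'⟩

/-- An empty carrier would leave the density with total mass zero, so some ratio is available below
`M`. -/
lemma M_nonneg (h : KnownDensitySetting ν Ξ p q Fhat f Lξ Lf M Mf) : 0 ≤ M := by
  by_cases hne : ∃ s, s ∈ Ξ (0 : EuclideanSpace ℝ (Fin n))
  · obtain ⟨s, hs⟩ := hne
    exact (div_nonneg (h.p_pos 0 s hs).le (h.q_nonneg s)).trans (h.ratio_le 0 s hs)
  · push Not at hne
    have := h.lintegral_p 0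
    simp [fun s => h.p_eq_zero 0 s (hne s)] at this

lemma p_le (h : KnownDensitySetting ν Ξ p q Fhat f Lξ Lf M Mf) (x : EuclideanSpace ℝ (Fin n))
    (s : S) : p x s ≤ M * q s := by
  by_cases hs : s ∈ Ξ x
  · exact (div_le_iff₀ (h.q_pos x s hs)).1 (h.ratio_le x s hs)
  · rw [h.p_eq_zero x s hs]
    exact mul_nonneg h.M_nonneg (h.q_nonneg s)

lemma measurable_p' (h : KnownDensitySetting ν Ξ p q Fhat f Lξ Lf M Mf)
    (x : EuclideanSpace ℝ (Fin n)) : Measurable (p x) :=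
  h.measurable_p.of_uncurry_left

lemma ae_bounded (h : KnownDensitySetting ν Ξ p q Fhat f Lξ Lf M Mf)
    (x : EuclideanSpace ℝ (Fin n)) : ∀ᵐ s ∂ν, p x s ≠ 0 → |Fhat x s| ≤ Mf := by
  filter_upwards [(ae_restrict_iff' (h.measurableSet_Ξ x)).1 (h.bounded x)] with s hs hp
  exact hs (h.p_ne_zero_iff.1 hp)

/-- The second moment of the increment of the importance-weighted sample function, with respect
to the reference measure. -/
lemma ae_mul_sq_sub_le (h : KnownDensitySetting ν Ξ p q Fhat f Lξ Lf M Mf)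
    (x y : EuclideanSpace ℝ (Fin n)) (hxy : ∀ᵐ s ∂ν, p x s = 0 ↔ p y s = 0) :
    ∀ᵐ s ∂ν, q s * (Fhat x s * p x s / q s - Fhat y s * p y s / q s) ^ 2
      ≤ q s * (2 * M ^ 2 * (Fhat x s - Fhat y s) ^ 2) + 2 * M * Mf ^ 2 *
        (p x s * Real.log (p x s / p y s) + p y s * Real.log (p y s / p x s)) := by
  filter_upwards [hxy, h.ae_bounded y] with s hs hb
  have hq0 := h.q_nonneg s
  by_cases hx : p x s = 0
  · simp only [hx, hs.1 hx]
    simp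
    positivity
  · have hy : p y s ≠ 0 := fun hy => hx (hs.2 hy)
    have hq : 0 < q s := h.q_pos x s (h.p_ne_zero_iff.1 hx)
    have hpx : 0 < p x s := lt_of_le_of_ne (h.p_nonneg x s) (Ne.symm hx)
    have hpy : 0 < p y s := lt_of_le_of_ne (h.p_nonneg y s) (Ne.symm hy)
    have h1 := sq_sub_le_mul_log_sub hpx hpy (h.p_le x s) (h.p_le y s)
    set k := p x s * Real.log (p x s / p y s) + p y s * Real.log (p y s / p x s)
    have h2 : Fhat y s ^ 2 ≤ Mf ^ 2 := by
      have := hb hy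
      rw [← sq_abs]; gcongr
    -- The increment splits into the change of the integrand at a fixed weight and the change of the
    -- weight at a fixed integrand; the factor 2 in `L₀²` comes from `(A + B)² ≤ 2A² + 2B²`.
    set A := (Fhat x s - Fhat y s) * (p x s / q s)
    set B := Fhat y s * ((p x s - p y s) / q s)
    have hAB : Fhat x s * p x s / q s - Fhat y s * p y s / q s = A + B := by
      simp only [A, B]; field_simp; ring
    have hA : A ^ 2 ≤ M ^ 2 * (Fhat x s - Fhat y s) ^ 2 := by
      have h3 : p x s / q s ≤ M := h.ratio_le x s (h.p_ne_zero_iff.1 hx)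
      have h4 : (p x s / q s) ^ 2 ≤ M ^ 2 := by gcongr
      calc A ^ 2 = (Fhat x s - Fhat y s) ^ 2 * (p x s / q s) ^ 2 := by simp only [A]; ring
        _ ≤ (Fhat x s - Fhat y s) ^ 2 * M ^ 2 := by gcongr
        _ = _ := by ring
    -- Both densities lie below `M q`, so the logarithmic-mean inequality with `m = M q` supplies
    -- exactly the factor `q` lost in the division.
    have hB : q s * B ^ 2 ≤ M * Mf ^ 2 * k := by
      calc q s * B ^ 2 = Fhat y s ^ 2 * ((p x s - p y s) ^ 2 / q s) := by
            simp only [B]; field_simp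
        _ ≤ Mf ^ 2 * ((M * q s * k) / q s) := by gcongr
        _ = _ := by field_simp
    rw [hAB]
    have h5 : (A + B) ^ 2 ≤ 2 * A ^ 2 + 2 * B ^ 2 := by nlinarith [sq_nonneg (A - B)]
    calc q s * (A + B) ^ 2 ≤ q s * (2 * A ^ 2 + 2 * B ^ 2) := by gcongr
      _ = q s * (2 * A ^ 2) + 2 * (q s * B ^ 2) := by ring
      _ ≤ q s * (2 * (M ^ 2 * (Fhat x s - Fhat y s) ^ 2)) + 2 * (M * Mf ^ 2 * k) := by gcongr
      _ = _ := by ring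

/-- Finiteness of both divergences makes the two laws mutually absolutely continuous, so the
pointwise estimate holds almost everywhere. Integrated, its logarithmic part is the symmetrised
divergence and its first part is the Lipschitz hypothesis under the sampling law. -/
lemma lintegral_sq_sub_le (h : KnownDensitySetting ν Ξ p q Fhat f Lξ Lf M Mf)
    (x y : EuclideanSpace ℝ (Fin n)) :
    ∫⁻ s, ENNReal.ofReal ((Fhat x s * p x s / q s - Fhat y s * p y s / q s) ^ 2)
        ∂(ν.withDensity fun s => ENNReal.ofReal (q s))
      ≤ ENNReal.ofReal (2 * (M ^ 2 * Lf ^ 2 + M * Mf ^ 2 * Lξ ^ 2) * ‖x - y‖ ^ 2) := by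
  have := h.sigmaFinite
  have hM := h.M_nonneg
  have hkl := h.klDiv_sym_le x y
  have hfin := ne_top_of_le_ne_top ENNReal.ofReal_ne_top hkl
  rw [ENNReal.add_ne_top] at hfin
  obtain ⟨hxy, ixy, kxy⟩ := toReal_klDiv_withDensity (h.measurable_p' x) (h.measurable_p' y)
    (h.p_nonneg x) (h.p_nonneg y) (h.lintegral_p x) (h.lintegral_p y) hfin.1
  obtain ⟨hyx, iyx, kyx⟩ := toReal_klDiv_withDensity (h.measurable_p' y) (h.measurable_p' x)
    (h.p_nonneg y) (h.p_nonneg x) (h.lintegral_p y) (h.lintegral_p x) hfin.2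
  have hk : ∫ s, (p x s * Real.log (p x s / p y s) + p y s * Real.log (p y s / p x s)) ∂ν
      ≤ Lξ ^ 2 * ‖x - y‖ ^ 2 := by
    rw [integral_add ixy iyx, ← kxy, ← kyx, ← ENNReal.toReal_add hfin.1 hfin.2]
    exact ENNReal.toReal_le_of_le_ofReal (by positivity) hkl
  have hiff : ∀ᵐ s ∂ν, p x s = 0 ↔ p y s = 0 := by
    filter_upwards [hxy, hyx] with s h1 h2 using ⟨h2, h1⟩
  -- The sign of the symmetrised integrand, needed to pass between `lintegral` and `integral`,
  -- follows from the logarithmic-mean inequality with `m` the larger density.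
  have hk0 : ∀ᵐ s ∂ν, 0 ≤ 2 * M * Mf ^ 2 *
      (p x s * Real.log (p x s / p y s) + p y s * Real.log (p y s / p x s)) := by
    filter_upwards [hiff] with s hs
    rcases (h.p_nonneg x s).eq_or_lt with hx | hx
    · simp [← hx, hs.1 hx.symm]
    · have hy : 0 < p y s := lt_of_le_of_ne (h.p_nonneg y s) fun hy => hx.ne' (hs.2 hy.symm)
      have h1 := sq_sub_le_mul_log_sub hx hy (le_max_left _ _) (le_max_right _ _)
      have h2 : 0 < max (p x s) (p y s) := hx.trans_le (le_max_left _ _)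
      have h3 := nonneg_of_mul_nonneg_right ((sq_nonneg _).trans h1) h2
      positivity
  have ik : Integrable (fun s => 2 * M * Mf ^ 2 * (p x s * Real.log (p x s / p y s)
      + p y s * Real.log (p y s / p x s))) ν := (ixy.add iyx).const_mul _
  have hmF : ∀ z, Measurable (Fhat z) := fun z => h.measurable_Fhat.of_uncurry_left
  have hmp := h.measurable_p'
  have hmq := h.measurable_q
  have hlip : ∫⁻ s, ENNReal.ofReal (q s * (Fhat x s - Fhat y s) ^ 2) ∂ν
      ≤ ENNReal.ofReal ((Lf * ‖x - y‖) ^ 2) := by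
    have h1 := (eLpNorm_two_le_ofReal_iff
      (mul_nonneg h.Lf_nonneg (norm_nonneg _))).1 (h.lipschitz x y)
    rw [lintegral_withDensity_eq_lintegral_mul _ hmq.ennreal_ofReal
      (by fun_prop)] at h1
    simpa only [Pi.mul_apply, ← ENNReal.ofReal_mul (h.q_nonneg _)] using h1
  rw [lintegral_withDensity_eq_lintegral_mul _ hmq.ennreal_ofReal
    (by fun_prop)]
  simp only [Pi.mul_apply, ← ENNReal.ofReal_mul (h.q_nonneg _)]
  calc _ ≤ ∫⁻ s, (ENNReal.ofReal (2 * M ^ 2) * ENNReal.ofReal (q s * (Fhat x s - Fhat y s) ^ 2)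
        + ENNReal.ofReal (2 * M * Mf ^ 2 * (p x s * Real.log (p x s / p y s)
          + p y s * Real.log (p y s / p x s)))) ∂ν := by
        refine lintegral_mono_ae ?_
        filter_upwards [h.ae_mul_sq_sub_le x y hiff, hk0] with s hs hs0
        refine (ENNReal.ofReal_le_ofReal hs).trans ?_
        refine ENNReal.ofReal_add_le.trans_eq ?_
        rw [← ENNReal.ofReal_mul (by positivity)]
        congr 2
        ring
    _ = ENNReal.ofReal (2 * M ^ 2) * ∫⁻ s, ENNReal.ofReal (q s * (Fhat x s - Fhat y s) ^ 2) ∂ν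
        + ENNReal.ofReal (2 * M * Mf ^ 2 * ∫ s, (p x s * Real.log (p x s / p y s)
          + p y s * Real.log (p y s / p x s)) ∂ν) := by
        rw [lintegral_add_right', lintegral_const_mul', ← integral_const_mul,
          ofReal_integral_eq_lintegral_ofReal ik hk0]
        · exact ENNReal.ofReal_ne_top
        · exact ik.1.aemeasurable.ennreal_ofReal
    _ ≤ ENNReal.ofReal (2 * M ^ 2) * ENNReal.ofReal ((Lf * ‖x - y‖) ^ 2)
        + ENNReal.ofReal (2 * M * Mf ^ 2 * (Lξ ^ 2 * ‖x - y‖ ^ 2)) := by gcongr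
    _ = _ := by
        rw [← ENNReal.ofReal_mul (by positivity), ← ENNReal.ofReal_add (by positivity)
          (by positivity)]
        congr 1
        ring

/-- The weight `p / q` turns an expectation under the sampling law into one under the
decision-dependent law: `q` cancels where `p > 0`, and elsewhere both integrands vanish. -/
lemma meanSquareLipschitz (h : KnownDensitySetting ν Ξ p q Fhat f Lξ Lf M Mf) :
    MeanSquareLipschitz (ν.withDensity fun s => ENNReal.ofReal (q s))
      (fun x s => Fhat x s * p x s / q s) f
      (√(2 * (M ^ 2 * Lf ^ 2 + M * Mf ^ 2 * Lξ ^ 2))) where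
  measurable := (h.measurable_Fhat.mul h.measurable_p).div (h.measurable_q.comp measurable_snd)
  integrable x := by
    have : IsFiniteMeasure (ν.withDensity fun s => ENNReal.ofReal (q s)) :=
      isFiniteMeasure_withDensity (by simp [h.lintegral_q])
    refine Integrable.of_bound (((h.measurable_Fhat.of_uncurry_left).mul (h.measurable_p' x)).div
      h.measurable_q).aestronglyMeasurable (|Mf| * M) ?_
    refine (withDensity_absolutelyContinuous ν _).ae_le ?_
    filter_upwards [h.ae_bounded x] with s hs
    rw [Real.norm_eq_abs, mul_div_assoc, abs_mul, abs_of_nonneg (div_nonneg (h.p_nonneg x s)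
      (h.q_nonneg s))]
    by_cases hx : p x s = 0
    · simp only [hx, zero_div, mul_zero]
      exact mul_nonneg (abs_nonneg _) h.M_nonneg
    · exact mul_le_mul ((hs hx).trans (le_abs_self _)) (h.ratio_le x s (h.p_ne_zero_iff.1 hx))
        (div_nonneg (h.p_nonneg x s) (h.q_nonneg s)) (abs_nonneg _)
  f_eq x := by
    rw [h.f_eq, integral_withDensity_eq_integral_toReal_smul (h.measurable_p' x).ennreal_ofReal
      (Eventually.of_forall fun s => ENNReal.ofReal_lt_top),
      integral_withDensity_eq_integral_toReal_smul h.measurable_q.ennreal_ofReal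
      (Eventually.of_forall fun s => ENNReal.ofReal_lt_top)]
    refine integral_congr_ae (Eventually.of_forall fun s => ?_)
    simp only [ENNReal.toReal_ofReal (h.p_nonneg x s), ENNReal.toReal_ofReal (h.q_nonneg s),
      smul_eq_mul]
    by_cases hx : p x s = 0
    · simp [hx]
    · have := (h.q_pos x s (h.p_ne_zero_iff.1 hx)).ne'
      field_simp
  lipschitz x y := by
    have hM := h.M_nonneg
    rw [mul_pow, Real.sq_sqrt (by positivity)]
    exact h.lintegral_sq_sub_le x y
  convex := h.convex

end KnownDensitySetting

end KnownDensity

lemma IsAdmissible.meanSquareLipschitz {P : Measure S} {Φ : EuclideanSpace ℝ (Fin n) → S → ℝ}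
    {f : EuclideanSpace ℝ (Fin n) → ℝ} {L₀ : ℝ} (hL : 0 ≤ L₀) (h : IsAdmissible P Φ f L₀) :
    MeanSquareLipschitz P Φ f L₀ := by
  rcases h with h | ⟨ν, Ξ, p, q, Fhat, Lξ, Lf, M, Mf, h, rfl, hΦ, rfl⟩ | ⟨d, ξ, 𝒟, Fhat, h, hΦ⟩
  · exact h.meanSquareLipschitz hL
  · obtain rfl : Φ = fun x s => Fhat x s * p x s / q s := funext fun x => funext (hΦ x)
    exact h.meanSquareLipschitz
  · obtain rfl : Φ = fun x s => Fhat x (ξ x s) := funext fun x => funext (hΦ x)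
    exact h.meanSquareLipschitz hL

end Settings

/-! ### Mean and second moment of the gradient estimator. -/

section Estimator

variable {n : ℕ} {S : Type*} [MeasurableSpace S] {P : Measure S}
  {Φ : EuclideanSpace ℝ (Fin n) → S → ℝ} {f : EuclideanSpace ℝ (Fin n) → ℝ} {L₀ : ℝ}

/-- The mean of the increment is at most its `L²` norm. The Lipschitz bound on `f` controls both the
smoothing bias and the diameter of `X`. -/
lemma MeanSquareLipschitz.lipschitzWith [IsProbabilityMeasure P]
    (h : MeanSquareLipschitz P Φ f L₀) (hL : 0 ≤ L₀) : LipschitzWith L₀.toNNReal f := by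
  refine LipschitzWith.of_dist_le_mul fun x y => ?_
  rw [Real.coe_toNNReal _ hL, dist_eq_norm, dist_eq_norm]
  have hr : 0 ≤ L₀ * ‖x - y‖ := by positivity
  have h1 := h.lipschitz x y
  have hint := (h.integrable x).sub (h.integrable y)
  have hm : MemLp (fun s => Φ x s - Φ y s) 2 P :=
    ⟨hint.1, ((eLpNorm_two_le_ofReal_iff hr).2 h1).trans_lt ENNReal.ofReal_lt_top⟩
  have h2 := sq_integral_le_integral_sq hm
  rw [← ofReal_integral_eq_lintegral_ofReal hm.integrable_sq
    (Eventually.of_forall fun s => sq_nonneg _), ENNReal.ofReal_le_ofReal_iff (sq_nonneg _)] at h1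
  rw [h.f_eq, h.f_eq, ← integral_sub (h.integrable x) (h.integrable y), Real.norm_eq_abs]
  exact abs_le_of_sq_le_sq (h2.trans h1) hr

lemma inner_single_one_left (i : Fin n) (w : EuclideanSpace ℝ (Fin n)) :
    ⟪EuclideanSpace.single i (1 : ℝ), w⟫ = w i := by
  rw [EuclideanSpace.inner_single_left, map_one, one_mul]

/-- This displays the displacement as the resampled vector of `map_resample_isoGaussian` along the
`i`-th basis vector. -/
lemma perturbedPoint_eq (x z : EuclideanSpace ℝ (Fin n)) (i : Fin n) (t : ℝ) :
    perturbedPoint x z i t = x + (-z + (⟪EuclideanSpace.single i (1 : ℝ), z⟫ + t)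
      • EuclideanSpace.single i (1 : ℝ)) := by
  ext j
  by_cases hj : j = i
  · subst hj; simp [perturbedPoint, inner_single_one_left]
  · simp [perturbedPoint, hj, sub_eq_add_neg]

lemma perturbedPoint_sub_perturbedPoint (x z : EuclideanSpace ℝ (Fin n)) (i : Fin n) (t t' : ℝ) :
    ‖perturbedPoint x z i t - perturbedPoint x z i t'‖ = |t - t'| := by
  rw [perturbedPoint_eq, perturbedPoint_eq]
  have : ∀ e : EuclideanSpace ℝ (Fin n), x + (-z + (⟪e, z⟫ + t) • e)
      - (x + (-z + (⟪e, z⟫ + t') • e)) = (t - t') • e := fun e => by module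
  rw [this, norm_smul]
  simp

lemma measurable_perturbedPoint (i : Fin n) :
    Measurable fun p : EuclideanSpace ℝ (Fin n) × EuclideanSpace ℝ (Fin n) × ℝ =>
      perturbedPoint p.1 p.2.1 i p.2.2 := by
  simp only [perturbedPoint_eq]
  fun_prop

lemma measurable_esGsEstimator (hΦ : Measurable (Function.uncurry Φ)) (η : ℝ) :
    Measurable fun p : EuclideanSpace ℝ (Fin n) × ℝ × EuclideanSpace ℝ (Fin n) × S =>
      esGsEstimator Φ η p.1 p.2.1 p.2.2.1 p.2.2.2 := by
  refine (WithLp.measurable_toLp 2 (Fin n → ℝ)).comp (measurable_pi_iff.2 fun i => ?_)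
  have hp : ∀ g : ℝ → ℝ, Measurable g →
      Measurable fun p : EuclideanSpace ℝ (Fin n) × ℝ × EuclideanSpace ℝ (Fin n) × S =>
        Φ (perturbedPoint p.1 p.2.2.1 i (g p.2.1)) p.2.2.2 := fun g hg =>
    hΦ.comp (((measurable_perturbedPoint i).comp (measurable_fst.prodMk
      ((measurable_fst.comp (measurable_snd.comp measurable_snd)).prodMk
        (hg.comp (measurable_fst.comp measurable_snd))))).prodMk
      (measurable_snd.comp (measurable_snd.comp measurable_snd)))
  exact ((hp (fun v => η * √(2 * v)) (by fun_prop)).sub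
    (hp (fun v => -(η * √(2 * v))) (by fun_prop))).div_const _

lemma measurable_esGsEstimator_right (hΦ : Measurable (Function.uncurry Φ)) (η : ℝ)
    (x : EuclideanSpace ℝ (Fin n)) :
    Measurable fun ξ : ℝ × EuclideanSpace ℝ (Fin n) × S =>
      esGsEstimator Φ η x ξ.1 ξ.2.1 ξ.2.2 :=
  (measurable_esGsEstimator hΦ η).comp (measurable_const.prodMk measurable_id)

lemma measurable_esGsEstimator_apply (hΦ : Measurable (Function.uncurry Φ)) (η : ℝ)
    (x : EuclideanSpace ℝ (Fin n)) (i : Fin n) :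
    Measurable fun ξ : ℝ × EuclideanSpace ℝ (Fin n) × S =>
      esGsEstimator Φ η x ξ.1 ξ.2.1 ξ.2.2 i :=
  ((measurable_pi_apply i).comp (WithLp.measurable_ofLp 2 (Fin n → ℝ))).comp
    (measurable_esGsEstimator_right hΦ η x)

instance : IsProbabilityMeasure (expMeasure 1) := isProbabilityMeasure_expMeasure one_pos

/-- The joint law of the noise `(V, Z, s)` of one step of the scheme. -/
noncomputable abbrev noiseLaw (n : ℕ) (η : ℝ) (P : Measure S) :
    Measure (ℝ × EuclideanSpace ℝ (Fin n) × S) :=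
  (expMeasure 1).prod ((isoGaussian n η).prod P)

namespace MeanSquareLipschitz

variable [IsProbabilityMeasure P]

/-- The two evaluation points are `2η√(2v)` apart, so the mean square over `s` is at most `8L₀²η²v /
(2πη²) = 4L₀²v/π`: the smoothing parameter cancels and `v` has mean one. -/
lemma lintegral_sq_esGsEstimator_le (h : MeanSquareLipschitz P Φ f L₀) {η : ℝ}
    (hη : 0 < η) (x : EuclideanSpace ℝ (Fin n)) (i : Fin n) :
    ∫⁻ ξ, ENNReal.ofReal (esGsEstimator Φ η x ξ.1 ξ.2.1 ξ.2.2 i ^ 2) ∂(noiseLaw n η P)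
      ≤ ENNReal.ofReal (4 * L₀ ^ 2 / Real.pi) := by
  have hpi := Real.pi_pos
  have hm : Measurable fun ξ : ℝ × EuclideanSpace ℝ (Fin n) × S =>
      ENNReal.ofReal (esGsEstimator Φ η x ξ.1 ξ.2.1 ξ.2.2 i ^ 2) :=
    ((measurable_esGsEstimator_apply h.measurable η x i).pow_const 2).ennreal_ofReal
  have hinner : ∀ (v : ℝ) (z : EuclideanSpace ℝ (Fin n)),
      ∫⁻ s, ENNReal.ofReal (esGsEstimator Φ η x v z s i ^ 2) ∂P
        ≤ ENNReal.ofReal (4 * L₀ ^ 2 / Real.pi) * ENNReal.ofReal v := by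
    intro v z
    have e1 : ∀ s, ENNReal.ofReal (esGsEstimator Φ η x v z s i ^ 2)
        = ENNReal.ofReal ((η ^ 2 * (2 * Real.pi))⁻¹) *
          ENNReal.ofReal ((Φ (perturbedPoint x z i (η * √(2 * v))) s
            - Φ (perturbedPoint x z i (-(η * √(2 * v)))) s) ^ 2) := fun s => by
      rw [← ENNReal.ofReal_mul (by positivity)]
      congr 1
      simp only [esGsEstimator]
      rw [div_pow, mul_pow, Real.sq_sqrt (by positivity), div_eq_inv_mul]
    simp_rw [e1]
    rw [lintegral_const_mul' _ _ ENNReal.ofReal_ne_top]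
    refine (mul_le_mul_right (h.lipschitz _ _) _).trans ?_
    rw [perturbedPoint_sub_perturbedPoint, ← ENNReal.ofReal_mul (by positivity),
      ← ENNReal.ofReal_mul (by positivity)]
    rcases le_total 0 v with hv | hv
    · refine (congrArg ENNReal.ofReal ?_).le
      rw [mul_pow, sq_abs, sub_neg_eq_add, ← two_mul, mul_pow, mul_pow,
        Real.sq_sqrt (by positivity)]
      field_simp
      ring
    -- For `v ≤ 0` the root takes the value 0 and the two evaluation points coincide.
    · rw [Real.sqrt_eq_zero_of_nonpos (by linarith)]
      simp
  rw [lintegral_prod _ hm.aemeasurable]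
  calc _ ≤ ∫⁻ v, ENNReal.ofReal (4 * L₀ ^ 2 / Real.pi) * ENNReal.ofReal v ∂(expMeasure 1) := by
        refine lintegral_mono fun v => ?_
        rw [lintegral_prod (fun p : EuclideanSpace ℝ (Fin n) × S =>
          ENNReal.ofReal (esGsEstimator Φ η x v p.1 p.2 i ^ 2))
          (hm.comp measurable_prodMk_left).aemeasurable]
        refine (lintegral_mono fun z => hinner v z).trans ?_
        simp
    _ = _ := by
        rw [lintegral_const_mul' _ _ ENNReal.ofReal_ne_top, lintegral_expMeasure_one_id, mul_one]

lemma memLp_esGsEstimator (h : MeanSquareLipschitz P Φ f L₀) {η : ℝ} (hη : 0 < η)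
    (x : EuclideanSpace ℝ (Fin n)) (i : Fin n) :
    MemLp (fun ξ : ℝ × EuclideanSpace ℝ (Fin n) × S => esGsEstimator Φ η x ξ.1 ξ.2.1 ξ.2.2 i) 2
      (noiseLaw n η P) := by
  have hpi := Real.pi_pos
  refine ⟨(measurable_esGsEstimator_apply h.measurable η x i).aestronglyMeasurable, lt_of_le_of_lt ((eLpNorm_two_le_ofReal_iff (Real.sqrt_nonneg _)).2 ?_)
    (ENNReal.ofReal_lt_top (r := √(4 * L₀ ^ 2 / Real.pi)))⟩
  rw [Real.sq_sqrt (by positivity)]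
  exact h.lintegral_sq_esGsEstimator_le hη x i

/-- Averaging over `s` replaces `Φ` by `f`; averaging over `v` at fixed `z` gives a Gaussian
integral weighted by the coordinate `t`; averaging over `z` reassembles a full Gaussian vector whose
`i`-th coordinate is `t`. -/
lemma integral_esGsEstimator (h : MeanSquareLipschitz P Φ f L₀) (hL : 0 ≤ L₀) {η : ℝ} (hη : 0 < η)
    (x : EuclideanSpace ℝ (Fin n)) (i : Fin n) :
    ∫ ξ, esGsEstimator Φ η x ξ.1 ξ.2.1 ξ.2.2 i ∂(noiseLaw n η P)
      = (η ^ 2)⁻¹ * ∫ w, f (x + w) * w i ∂(isoGaussian n η) := by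
  set e : EuclideanSpace ℝ (Fin n) := EuclideanSpace.single i (1 : ℝ) with he
  have he1 : ‖e‖ = 1 := by simp [he]
  have hK := h.lipschitzWith hL
  have hint := (h.memLp_esGsEstimator hη x i).integrable (by norm_num)
  -- Reassociated so that `s` can be integrated first, before `v` and `z` are exchanged.
  have hassoc := measurePreserving_prodAssoc (expMeasure 1) (isoGaussian n η) P
  have hint' : Integrable (fun p : (ℝ × EuclideanSpace ℝ (Fin n)) × S =>
      esGsEstimator Φ η x p.1.1 p.1.2 p.2 i) (((expMeasure 1).prod (isoGaussian n η)).prod P) :=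
    hassoc.integrable_comp_of_integrable hint
  have hG : ∀ p : ℝ × EuclideanSpace ℝ (Fin n), ∫ s, esGsEstimator Φ η x p.1 p.2 s i ∂P
      = (f (perturbedPoint x p.2 i (η * √(2 * p.1)))
          - f (perturbedPoint x p.2 i (-(η * √(2 * p.1))))) / (η * √(2 * Real.pi)) := fun p => by
    simp only [esGsEstimator]
    rw [integral_div, integral_sub (h.integrable _) (h.integrable _), h.f_eq, h.f_eq]
  have hGint := hint'.integral_prod_left
  simp only [hG] at hGint
  have e1 : ∫ ξ, esGsEstimator Φ η x ξ.1 ξ.2.1 ξ.2.2 i ∂(noiseLaw n η P)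
      = ∫ p : (ℝ × EuclideanSpace ℝ (Fin n)) × S, esGsEstimator Φ η x p.1.1 p.1.2 p.2 i
        ∂(((expMeasure 1).prod (isoGaussian n η)).prod P) :=
    (hassoc.integral_comp' (fun ξ : ℝ × EuclideanSpace ℝ (Fin n) × S =>
      esGsEstimator Φ η x ξ.1 ξ.2.1 ξ.2.2 i)).symm
  rw [e1, integral_prod _ hint']
  simp only [hG]
  rw [integral_prod_symm _ hGint]
  have hshift : LipschitzWith L₀.toNNReal (fun w => f (x + w)) :=
    LipschitzWith.of_dist_le_mul fun v w => by simpa using hK.dist_le_mul (x + v) (x + w)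
  have hwi : ∀ w : EuclideanSpace ℝ (Fin n), w i = ⟪e, w⟫ := fun w => by rw [he, inner_single_one_left]
  simp only [hwi]
  rw [integral_isoGaussian_eq_integral_integral η he1
    (hshift.integrable_mul_inner_isoGaussian η e), ← integral_const_mul]
  refine integral_congr_ae (Eventually.of_forall fun z => ?_)
  set H : ℝ → ℝ := fun t => f (perturbedPoint x z i t) with hH
  have hHK : LipschitzWith L₀.toNNReal H := by
    refine LipschitzWith.of_dist_le_mul fun a b => ?_
    refine (hK.dist_le_mul _ _).trans_eq ?_
    rw [dist_eq_norm, perturbedPoint_sub_perturbedPoint, Real.dist_eq]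
  have e2 : ∀ t, f (x + (-z + (⟪e, z⟫ + t) • e)) * ⟪e, -z + (⟪e, z⟫ + t) • e⟫ = H t * t := by
    intro t
    have : ⟪e, -z + (⟪e, z⟫ + t) • e⟫ = t := by
      rw [inner_add_right, inner_neg_right, inner_smul_right, real_inner_self_eq_norm_sq, he1]
      ring
    rw [this, hH]
    simp only [perturbedPoint_eq, ← he]
  simp only [e2]
  rw [integral_div, integral_expMeasure_sub_eq_integral_gaussianReal hHK hη]
  have : √(2 * Real.pi) ≠ 0 := by have := Real.pi_pos; positivity
  field_simp

lemma integrable_inner_esGsEstimator (h : MeanSquareLipschitz P Φ f L₀) {η : ℝ}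
    (hη : 0 < η) (x u : EuclideanSpace ℝ (Fin n)) :
    Integrable (fun ξ : ℝ × EuclideanSpace ℝ (Fin n) × S =>
      ⟪u, esGsEstimator Φ η x ξ.1 ξ.2.1 ξ.2.2⟫) (noiseLaw n η P) := by
  simp only [PiLp.inner_apply]
  refine integrable_finsetSum _ fun i _ => ?_
  simpa [mul_comm] using
    ((h.memLp_esGsEstimator hη x i).integrable (by norm_num)).const_mul (u i)

lemma integral_inner_esGsEstimator (h : MeanSquareLipschitz P Φ f L₀) (hL : 0 ≤ L₀) {η : ℝ}
    (hη : 0 < η) (x u : EuclideanSpace ℝ (Fin n)) :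
    ∫ ξ, ⟪u, esGsEstimator Φ η x ξ.1 ξ.2.1 ξ.2.2⟫ ∂(noiseLaw n η P)
      = (η ^ 2)⁻¹ * ∫ w, f (x + w) * ⟪u, w⟫ ∂(isoGaussian n η) := by
  have hshift : LipschitzWith L₀.toNNReal (fun w => f (x + w)) :=
    LipschitzWith.of_dist_le_mul fun v w => by
      simpa using (h.lipschitzWith hL).dist_le_mul (x + v) (x + w)
  have e0 : ∀ a : EuclideanSpace ℝ (Fin n), ⟪u, a⟫ = ∑ i, u i * a i := fun a => by
    simp [PiLp.inner_apply, mul_comm]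
  simp only [e0, Finset.mul_sum]
  rw [integral_finsetSum _ fun i _ =>
    ((h.memLp_esGsEstimator hη x i).integrable (by norm_num)).const_mul (u i),
    integral_finsetSum, Finset.mul_sum]
  · refine Finset.sum_congr rfl fun i _ => ?_
    rw [integral_const_mul, h.integral_esGsEstimator hL hη x i, mul_left_comm, ← integral_const_mul]
    congr 2
    funext w
    ring
  · intro i _
    have := (hshift.integrable_mul_inner_isoGaussian η (EuclideanSpace.single i (1 : ℝ))).const_mul
      (u i)
    refine this.congr (Eventually.of_forall fun w => ?_)
    simp only [inner_single_one_left]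
    ring

lemma integral_norm_sq_esGsEstimator_le (h : MeanSquareLipschitz P Φ f L₀) {η : ℝ}
    (hη : 0 < η) (x : EuclideanSpace ℝ (Fin n)) :
    Integrable (fun ξ : ℝ × EuclideanSpace ℝ (Fin n) × S =>
      ‖esGsEstimator Φ η x ξ.1 ξ.2.1 ξ.2.2‖ ^ 2) (noiseLaw n η P) ∧
    ∫ ξ, ‖esGsEstimator Φ η x ξ.1 ξ.2.1 ξ.2.2‖ ^ 2 ∂(noiseLaw n η P)
      ≤ 4 * L₀ ^ 2 * n / Real.pi := by
  have hpi := Real.pi_pos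
  simp only [EuclideanSpace.real_norm_sq_eq]
  have hi := fun i => (h.memLp_esGsEstimator hη x i).integrable_sq
  refine ⟨integrable_finsetSum _ fun i _ => hi i, ?_⟩
  rw [integral_finsetSum _ fun i _ => hi i]
  have hle : ∀ i : Fin n, ∫ ξ, esGsEstimator Φ η x ξ.1 ξ.2.1 ξ.2.2 i ^ 2 ∂(noiseLaw n η P)
      ≤ 4 * L₀ ^ 2 / Real.pi := fun i => by
    have h1 := h.lintegral_sq_esGsEstimator_le hη x i
    rwa [← ofReal_integral_eq_lintegral_ofReal (hi i) (Eventually.of_forall fun s => sq_nonneg _),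
      ENNReal.ofReal_le_ofReal_iff (by positivity)] at h1
  refine (Finset.sum_le_sum fun i _ => hle i).trans_eq ?_
  simp
  ring

/-- The conditional mean square distance to `y` after one unprojected step from `x`. -/
lemma lintegral_step_le (h : MeanSquareLipschitz P Φ f L₀) (hL : 0 ≤ L₀) {η γ μ : ℝ} (hη : 0 < η)
    (hγ : 0 ≤ γ) {x y : EuclideanSpace ℝ (Fin n)} (hxy : μ / 2 * ‖x - y‖ ^ 2 ≤ f x - f y) :
    0 ≤ (1 - μ * γ) * ‖x - y‖ ^ 2
        + (2 * L₀ * √n * (γ * η) + 4 * L₀ ^ 2 * n / Real.pi * γ ^ 2) ∧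
    ∫⁻ ξ, ENNReal.ofReal (‖x - γ • esGsEstimator Φ η x ξ.1 ξ.2.1 ξ.2.2 - y‖ ^ 2)
        ∂(noiseLaw n η P)
      ≤ ENNReal.ofReal ((1 - μ * γ) * ‖x - y‖ ^ 2
        + (2 * L₀ * √n * (γ * η) + 4 * L₀ ^ 2 * n / Real.pi * γ ^ 2)) := by
  have e : ∀ g : EuclideanSpace ℝ (Fin n), ‖x - γ • g - y‖ ^ 2
      = ‖x - y‖ ^ 2 - 2 * γ * ⟪x - y, g⟫ + γ ^ 2 * ‖g‖ ^ 2 := fun g => by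
    have : x - γ • g - y = (x - y) - γ • g := by abel
    rw [this, norm_sub_sq_real, inner_smul_right, norm_smul, mul_pow, Real.norm_eq_abs, sq_abs]
    ring
  obtain ⟨i2, b2⟩ := h.integral_norm_sq_esGsEstimator_le hη x
  have i1 := h.integrable_inner_esGsEstimator hη x (x - y)
  have b1 := h.convex.sub_le_integral_mul_inner_isoGaussian (h.lipschitzWith hL) hη x y
  rw [← h.integral_inner_esGsEstimator hL hη, Real.coe_toNNReal _ hL] at b1
  have i3 : Integrable (fun ξ : ℝ × EuclideanSpace ℝ (Fin n) × S =>
      ‖x - y‖ ^ 2 - 2 * γ * ⟪x - y, esGsEstimator Φ η x ξ.1 ξ.2.1 ξ.2.2⟫) (noiseLaw n η P) :=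
    (integrable_const _).sub (i1.const_mul (2 * γ))
  have i4 := i2.const_mul (γ ^ 2)
  have i5 : Integrable (fun ξ : ℝ × EuclideanSpace ℝ (Fin n) × S =>
      ‖x - y‖ ^ 2 - 2 * γ * ⟪x - y, esGsEstimator Φ η x ξ.1 ξ.2.1 ξ.2.2⟫
        + γ ^ 2 * ‖esGsEstimator Φ η x ξ.1 ξ.2.1 ξ.2.2‖ ^ 2) (noiseLaw n η P) := i3.add i4
  have hs : ∫ ξ, (‖x - y‖ ^ 2 - 2 * γ * ⟪x - y, esGsEstimator Φ η x ξ.1 ξ.2.1 ξ.2.2⟫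
      + γ ^ 2 * ‖esGsEstimator Φ η x ξ.1 ξ.2.1 ξ.2.2‖ ^ 2) ∂(noiseLaw n η P)
      = ‖x - y‖ ^ 2 - 2 * γ * ∫ ξ, ⟪x - y, esGsEstimator Φ η x ξ.1 ξ.2.1 ξ.2.2⟫ ∂(noiseLaw n η P)
        + γ ^ 2 * ∫ ξ, ‖esGsEstimator Φ η x ξ.1 ξ.2.1 ξ.2.2‖ ^ 2 ∂(noiseLaw n η P) := by
    rw [integral_add i3 i4, integral_sub (integrable_const _) (i1.const_mul _),
      integral_const_mul, integral_const_mul]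
    simp
  -- The factor `1 - μγ` may be negative, so the sign of the final bound is not visible from its
  -- form; it is inherited from the nonnegative integral below it.
  have h0 : ∀ ξ : ℝ × EuclideanSpace ℝ (Fin n) × S,
      0 ≤ ‖x - y‖ ^ 2 - 2 * γ * ⟪x - y, esGsEstimator Φ η x ξ.1 ξ.2.1 ξ.2.2⟫
      + γ ^ 2 * ‖esGsEstimator Φ η x ξ.1 ξ.2.1 ξ.2.2‖ ^ 2 := fun ξ => by
    rw [← e]; positivity
  have hle : ∫ ξ, (‖x - y‖ ^ 2 - 2 * γ * ⟪x - y, esGsEstimator Φ η x ξ.1 ξ.2.1 ξ.2.2⟫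
      + γ ^ 2 * ‖esGsEstimator Φ η x ξ.1 ξ.2.1 ξ.2.2‖ ^ 2) ∂(noiseLaw n η P)
      ≤ (1 - μ * γ) * ‖x - y‖ ^ 2
        + (2 * L₀ * √n * (γ * η) + 4 * L₀ ^ 2 * n / Real.pi * γ ^ 2) := by
    rw [hs]
    have b1' := mul_le_mul_of_nonneg_left b1 hγ
    have b2' := mul_le_mul_of_nonneg_left b2 (sq_nonneg γ)
    have b3' := mul_le_mul_of_nonneg_left hxy hγ
    nlinarith
  refine ⟨(integral_nonneg h0).trans hle, ?_⟩
  simp only [e]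
  rw [← ofReal_integral_eq_lintegral_ofReal i5 (Eventually.of_forall h0)]
  exact ENNReal.ofReal_le_ofReal hle

end MeanSquareLipschitz

end Estimator

/-! ### Strong convexity and Euclidean projections. -/

section Optimization

variable {n : ℕ} {X : Set (EuclideanSpace ℝ (Fin n))} {f : EuclideanSpace ℝ (Fin n) → ℝ} {μ : ℝ}
  {x xs : EuclideanSpace ℝ (Fin n)}

/-- Quadratic growth: compare `xs` with the point `a x + (1 - a) xs`, divide by `a`, and let `a`
tend to zero. -/
lemma StrongConvexOn.mul_norm_sub_sq_le (hf : StrongConvexOn X μ f) (hxs : xs ∈ optimalSet f X)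
    (hx : x ∈ X) : μ / 2 * ‖x - xs‖ ^ 2 ≤ f x - f xs := by
  have key : ∀ a ∈ Set.Ioo (0 : ℝ) 1, (1 - a) * (μ / 2 * ‖x - xs‖ ^ 2) ≤ f x - f xs := by
    rintro a ⟨ha0, ha1⟩
    have h1 := hf.2 hx hxs.1 ha0.le (sub_nonneg.2 ha1.le) (by ring)
    have h2 := hxs.2 _ (hf.1 hx hxs.1 ha0.le (sub_nonneg.2 ha1.le) (by ring))
    simp only [smul_eq_mul] at h1
    have h3 : a * ((1 - a) * (μ / 2 * ‖x - xs‖ ^ 2)) ≤ a * (f x - f xs) := by linarith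
    exact le_of_mul_le_mul_left h3 ha0
  have hlim : Tendsto (fun a : ℝ => (1 - a) * (μ / 2 * ‖x - xs‖ ^ 2)) (𝓝[>] 0)
      (𝓝 ((1 - 0) * (μ / 2 * ‖x - xs‖ ^ 2))) :=
    ((Continuous.tendsto (by fun_prop) 0).mono_left nhdsWithin_le_nhds)
  rw [sub_zero, one_mul] at hlim
  refine le_of_tendsto hlim ?_
  filter_upwards [Ioo_mem_nhdsGT one_pos] with a ha using key a ha

lemma StrongConvexOn.optimalSet_eq_singleton (hf : StrongConvexOn X μ f) (hμ : 0 < μ)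
    (hxs : xs ∈ optimalSet f X) : optimalSet f X = {xs} := by
  refine Set.eq_singleton_iff_unique_mem.2 ⟨hxs, fun y hy => ?_⟩
  have h1 := hf.mul_norm_sub_sq_le hxs hy.1
  have h2 := hy.2 xs hxs.1
  have h3 : ‖y - xs‖ ^ 2 ≤ 0 := by
    by_contra! h
    have := mul_pos (half_pos hμ) h
    linarith
  have h4 : ‖y - xs‖ = 0 := by nlinarith [norm_nonneg (y - xs)]
  exact sub_eq_zero.1 (norm_eq_zero.1 h4)

/-- The domain of a function that is both strongly convex and Lipschitz is bounded. -/
lemma StrongConvexOn.norm_sub_sq_le (hf : StrongConvexOn X μ f) (hμ : 0 < μ) {L : ℝ} (hL : 0 ≤ L)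
    (hLip : LipschitzWith L.toNNReal f) (hxs : xs ∈ optimalSet f X) (hx : x ∈ X) :
    ‖x - xs‖ ^ 2 ≤ 16 / 9 * (L / μ) ^ 2 := by
  set r := ‖x - xs‖ with hr
  have h1 := hf.mul_norm_sub_sq_le hxs hx
  have h2 := hf.2 hx hxs.1 (show (0 : ℝ) ≤ 1 / 2 by norm_num) (show (0 : ℝ) ≤ 1 / 2 by norm_num)
    (by norm_num)
  have h3 := hLip.norm_sub_le x ((1 / 2 : ℝ) • x + (1 / 2 : ℝ) • xs)
  have h4 : ‖x - ((1 / 2 : ℝ) • x + (1 / 2 : ℝ) • xs)‖ = r / 2 := by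
    have : x - ((1 / 2 : ℝ) • x + (1 / 2 : ℝ) • xs) = (1 / 2 : ℝ) • (x - xs) := by module
    rw [this, norm_smul, hr]
    norm_num
    ring
  rw [h4, Real.coe_toNNReal _ hL] at h3
  have h5 := (le_abs_self _).trans h3
  simp only [smul_eq_mul, ← hr] at h1 h2
  -- The drop of `f` from `x` to the midpoint is at most `L r / 2`, and at least `μ r²/4` by growth
  -- plus `μ r²/8` by strong convexity.
  have h6 : r * (3 / 4 * μ * r) ≤ r * L := by nlinarith
  have hr0 : 0 ≤ r := norm_nonneg _
  have h7 : r ≤ 4 / 3 * (L / μ) := by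
    rcases hr0.eq_or_lt with h | h
    · rw [← h]; positivity
    · have := le_of_mul_le_mul_left h6 h
      rw [← mul_div_assoc, le_div_iff₀ hμ]
      linarith
  calc r ^ 2 ≤ (4 / 3 * (L / μ)) ^ 2 := by gcongr
    _ = _ := by ring

lemma IsProjection.inner_le_zero (hX : Convex ℝ X) {u p : EuclideanSpace ℝ (Fin n)}
    (h : IsProjection X u p) {y : EuclideanSpace ℝ (Fin n)} (hy : y ∈ X) :
    ⟪u - p, y - p⟫ ≤ 0 := by
  refine (norm_eq_iInf_iff_real_inner_le_zero hX h.1).1 ?_ y hy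
  have : Nonempty X := ⟨⟨p, h.1⟩⟩
  refine le_antisymm (le_ciInf fun w => h.2 w w.2) ?_
  exact ciInf_le ⟨0, by rintro _ ⟨w, rfl⟩; exact norm_nonneg _⟩ (⟨p, h.1⟩ : X)

/-- Add the two variational inequalities and apply Cauchy–Schwarz. -/
lemma IsProjection.norm_sub_le (hX : Convex ℝ X) {u p v q : EuclideanSpace ℝ (Fin n)}
    (hp : IsProjection X u p) (hq : IsProjection X v q) : ‖p - q‖ ≤ ‖u - v‖ := by
  have h1 := hp.inner_le_zero hX hq.1
  have h2 := hq.inner_le_zero hX hp.1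
  have h3 : ‖p - q‖ ^ 2 ≤ ⟪u - v, p - q⟫ := by
    have e1 : ⟪u - p, q - p⟫ = -⟪u - p, p - q⟫ := by rw [← inner_neg_right, neg_sub]
    have e2 : ⟪u - v, p - q⟫ = ⟪u - p, p - q⟫ + ⟪p - q, p - q⟫ - ⟪v - q, p - q⟫ := by
      rw [← inner_add_left, ← inner_sub_left]; congr 1; abel
    rw [e2, real_inner_self_eq_norm_sq]
    linarith
  have h4 := real_inner_le_norm (u - v) (p - q)
  rcases (norm_nonneg (p - q)).eq_or_lt with h | h
  · rw [← h]; exact norm_nonneg _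
  · refine le_of_mul_le_mul_right ?_ h
    nlinarith

lemma isProjection_self {p : EuclideanSpace ℝ (Fin n)} (hp : p ∈ X) : IsProjection X p p :=
  ⟨hp, fun y _ => by simp⟩

lemma IsProjection.closure {u p : EuclideanSpace ℝ (Fin n)} (h : IsProjection X u p) :
    IsProjection (closure X) u p :=
  ⟨subset_closure h.1, fun y hy => closure_minimal (s := X) (t := {y | ‖u - p‖ ≤ ‖u - y‖})
    (fun z hz => h.2 z hz) (isClosed_le (by fun_prop) (by fun_prop)) hy⟩

/-- `X` need not be closed. The projection on its closure always exists, is 1-Lipschitz, and agrees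
with every nearest point that lies in `X`; hence the iterates are measurable functions of the past,
although a run only prescribes them pointwise. -/
lemma exists_measurable_projection (hX : Convex ℝ X) (hne : X.Nonempty) :
    ∃ π : EuclideanSpace ℝ (Fin n) → EuclideanSpace ℝ (Fin n), Measurable π ∧
      ∀ u p, IsProjection X u p → p = π u := by
  have hex : ∀ u, ∃ p, IsProjection (closure X) u p := fun u => by
    obtain ⟨p, hp, h⟩ := exists_norm_eq_iInf_of_complete_convex hne.closure
      isClosed_closure.isComplete hX.closure u
    refine ⟨p, hp, fun y hy => ?_⟩
    rw [h]
    exact ciInf_le ⟨0, by rintro _ ⟨w, rfl⟩; exact norm_nonneg _⟩ (⟨y, hy⟩ : closure X)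
  choose π hπ using hex
  refine ⟨π, ?_, fun u p hp => ?_⟩
  · refine (LipschitzWith.of_dist_le_mul (K := 1) fun u v => ?_).continuous.measurable
    simpa [dist_eq_norm] using (hπ u).norm_sub_le hX.closure (hπ v)
  · have := hp.closure.norm_sub_le hX.closure (hπ u)
    rw [sub_self, norm_zero] at this
    exact sub_eq_zero.1 (norm_le_zero_iff.1 this)

end Optimization

/-! ### Integrating out independent noise. -/

section Independence

variable {Ω α β T : Type*} {m mΩ : MeasurableSpace Ω} [MeasurableSpace α] [MeasurableSpace β]
  [MeasurableSpace T] {ρ : Measure Ω} [IsProbabilityMeasure ρ]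

/-- The joint law is a product `A ⊗ (B ⊗ N)`, and products of measures reassociate. -/
lemma ProbabilityTheory.IndepFun.prodMk_left_of_prodMk {A : Ω → α} {B : Ω → β} {N : Ω → T}
    (hA : Measurable A)
    (hB : Measurable B) (hN : Measurable N) (h : IndepFun A (fun ω => (B ω, N ω)) ρ)
    (hBN : IndepFun B N ρ) : IndepFun (fun ω => (A ω, B ω)) N ρ := by
  have hAB : IndepFun A B ρ := h.comp measurable_id measurable_fst
  have := Measure.isProbabilityMeasure_map (μ := ρ) hA.aemeasurable
  have := Measure.isProbabilityMeasure_map (μ := ρ) hB.aemeasurable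
  have := Measure.isProbabilityMeasure_map (μ := ρ) hN.aemeasurable
  rw [indepFun_iff_map_prod_eq_prod_map_map (by fun_prop) (by fun_prop)] at *
  rw [hBN] at h
  rw [hAB, ← (measurePreserving_prodAssoc (ρ.map A) (ρ.map B) (ρ.map N)).symm.map_eq, ← h,
    Measure.map_map (by fun_prop) (by fun_prop)]
  rfl

/-- Integrating out an independent variable, on an event of the conditioning `σ`-algebra. -/
lemma setLIntegral_comp_of_indep {Y : Ω → α} {N : Ω → T}
    (hm : m ≤ mΩ) (hN : Measurable N) (h : Indep m (MeasurableSpace.comap N inferInstance) ρ)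
    (hY : Measurable[m] Y) {A : Set Ω} (hA : MeasurableSet[m] A) {G : α → T → ℝ≥0∞}
    (hG : Measurable (Function.uncurry G)) :
    ∫⁻ ω in A, G (Y ω) (N ω) ∂ρ = ∫⁻ ω in A, ∫⁻ t, G (Y ω) t ∂(ρ.map N) ∂ρ := by
  have := Measure.isProbabilityMeasure_map (μ := ρ) hN.aemeasurable
  have hY' : Measurable Y := hY.mono hm le_rfl
  have hA' : MeasurableSet A := hm _ hA
  -- The indicator of the event is carried as an extra coordinate beside `Y`, so independence of the
  -- pair from `N` and Tonelli take the place of conditional expectations.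
  have hind : Measurable[m] (A.indicator (fun _ => (1 : ℝ≥0∞))) := measurable_const.indicator hA
  have hYA : Measurable[m] fun ω => (A.indicator (fun _ => (1 : ℝ≥0∞)) ω, Y ω) := hind.prodMk hY
  have hYA' : Measurable fun ω => (A.indicator (fun _ => (1 : ℝ≥0∞)) ω, Y ω) := hYA.mono hm le_rfl
  have hi : IndepFun (fun ω => (A.indicator (fun _ => (1 : ℝ≥0∞)) ω, Y ω)) N ρ := by
    rw [IndepFun_iff_Indep]
    exact indep_of_indep_of_le_left h hYA.comap_le
  rw [indepFun_iff_map_prod_eq_prod_map_map hYA'.aemeasurable hN.aemeasurable] at hi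
  have hG2 : Measurable fun p : (ℝ≥0∞ × α) × T => p.1.1 * G p.1.2 p.2 :=
    (measurable_fst.comp measurable_fst).mul
      (hG.comp ((measurable_snd.comp measurable_fst).prodMk measurable_snd))
  have e1 : ∀ g : Ω → ℝ≥0∞, ∫⁻ ω in A, g ω ∂ρ
      = ∫⁻ ω, A.indicator (fun _ => (1 : ℝ≥0∞)) ω * g ω ∂ρ := fun g => by
    rw [← lintegral_indicator hA']
    refine lintegral_congr fun ω => ?_
    by_cases hω : ω ∈ A <;> simp [hω]
  rw [e1, e1]
  calc _ = ∫⁻ p, p.1.1 * G p.1.2 p.2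
        ∂(ρ.map fun ω => ((A.indicator (fun _ => (1 : ℝ≥0∞)) ω, Y ω), N ω)) :=
        (lintegral_map hG2 (hYA'.prodMk hN)).symm
    _ = ∫⁻ y, ∫⁻ t, y.1 * G y.2 t ∂(ρ.map N)
        ∂(ρ.map fun ω => (A.indicator (fun _ => (1 : ℝ≥0∞)) ω, Y ω)) := by
        rw [hi, lintegral_prod _ hG2.aemeasurable]
    _ = ∫⁻ ω, ∫⁻ t, A.indicator (fun _ => (1 : ℝ≥0∞)) ω * G (Y ω) t ∂(ρ.map N) ∂ρ :=
        lintegral_map hG2.lintegral_prod_right' hYA'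
    _ = _ := by
        refine lintegral_congr fun ω => ?_
        exact lintegral_const_mul _ (hG.comp measurable_prodMk_left)

end Independence

/-! ### The filtration of a run. -/

section Run

variable {n : ℕ} {S Ω : Type*} [MeasurableSpace S] [mΩ : MeasurableSpace Ω]
  {X : Set (EuclideanSpace ℝ (Fin n))} {P : Measure S}
  {Φ : EuclideanSpace ℝ (Fin n) → S → ℝ} {γ η : ℕ → ℝ} {Pr : Measure Ω}
  {V : ℕ → Ω → ℝ} {Z : ℕ → Ω → EuclideanSpace ℝ (Fin n)} {s : ℕ → Ω → S}
  {x : ℕ → Ω → EuclideanSpace ℝ (Fin n)}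

namespace IsRun

lemma mem (h : IsRun X P Φ γ η Pr V Z s x) (k : ℕ) (ω : Ω) : x k ω ∈ X := by
  cases k with
  | zero => exact h.init_mem ω
  | succ k => exact (h.step k ω).1

lemma measurable_noise (h : IsRun X P Φ γ η Pr V Z s x) (k : ℕ) :
    Measurable fun ω => (V k ω, Z k ω, s k ω) :=
  (h.measurable_V k).prodMk ((h.measurable_Z k).prodMk (h.measurable_s k))

/-- The initial iterate and the noise of the first `k` steps. -/
def history (_ : IsRun X P Φ γ η Pr V Z s x) (k : ℕ) (ω : Ω) :
    EuclideanSpace ℝ (Fin n) × (Finset.range k → ℝ × EuclideanSpace ℝ (Fin n) × S) :=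
  (x 0 ω, fun j => (V j ω, Z j ω, s j ω))

lemma measurable_history (h : IsRun X P Φ γ η Pr V Z s x) (k : ℕ) : Measurable (h.history k) :=
  h.measurable_init.prodMk (measurable_pi_iff.2 fun j => h.measurable_noise j)

/-- The filtration generated by the initial iterate and the noise. -/
def filtration (h : IsRun X P Φ γ η Pr V Z s x) : Filtration ℕ mΩ where
  seq k := MeasurableSpace.comap (h.history k) inferInstance
  mono' := by
    intro j k hjk
    have hsub : ∀ i : Finset.range j, (i : ℕ) ∈ Finset.range k := fun i =>
      Finset.range_mono hjk i.2
    let g : EuclideanSpace ℝ (Fin n) × (Finset.range k → ℝ × EuclideanSpace ℝ (Fin n) × S) →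
        EuclideanSpace ℝ (Fin n) × (Finset.range j → ℝ × EuclideanSpace ℝ (Fin n) × S) :=
      fun p => (p.1, fun i => p.2 ⟨i, hsub i⟩)
    have hg : Measurable g := by
      refine measurable_fst.prodMk (measurable_pi_iff.2 fun i => ?_)
      exact (measurable_pi_apply _).comp measurable_snd
    have : h.history j = g ∘ h.history k := rfl
    simp only [this]
    rw [← MeasurableSpace.comap_comp]
    exact MeasurableSpace.comap_mono hg.comap_le
  le' k := (h.measurable_history k).comap_le

lemma measurable_filtration_noise (h : IsRun X P Φ γ η Pr V Z s x) (k : ℕ) :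
    Measurable[h.filtration (k + 1)] fun ω => (V k ω, Z k ω, s k ω) := by
  have h1 : Measurable[h.filtration (k + 1)] (h.history (k + 1)) := comap_measurable _
  have h2 : Measurable fun p : EuclideanSpace ℝ (Fin n) ×
      (Finset.range (k + 1) → ℝ × EuclideanSpace ℝ (Fin n) × S) =>
      p.2 ⟨k, Finset.self_mem_range_succ k⟩ := (measurable_pi_apply _).comp measurable_snd
  exact h2.comp h1

lemma measurable_filtration (h : IsRun X P Φ γ η Pr V Z s x) (hX : Convex ℝ X)
    (hne : X.Nonempty) (hΦ : Measurable (Function.uncurry Φ)) (k : ℕ) :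
    Measurable[h.filtration k] (x k) := by
  obtain ⟨π, hπ, hproj⟩ := exists_measurable_projection hX hne
  induction k with
  | zero =>
    have h1 : Measurable[h.filtration 0] (h.history 0) := comap_measurable _
    exact measurable_fst.comp h1
  | succ k ih =>
    have h1 : x (k + 1) = fun ω => π (x k ω - γ k • esGsEstimator Φ (η k) (x k ω) (V k ω) (Z k ω)
        (s k ω)) := funext fun ω => hproj _ _ (h.step k ω)
    have h2 : Measurable[h.filtration (k + 1)] (x k) := ih.mono (h.filtration.mono k.le_succ) le_rfl
    have h3 : Measurable[h.filtration (k + 1)] fun ω =>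
        esGsEstimator Φ (η k) (x k ω) (V k ω) (Z k ω) (s k ω) :=
      (measurable_esGsEstimator hΦ (η k)).comp (h2.prodMk (h.measurable_filtration_noise k))
    rw [h1]
    exact hπ.comp (h2.sub (h3.const_smul (γ k)))

lemma indep_filtration_noise [IsProbabilityMeasure Pr] (h : IsRun X P Φ γ η Pr V Z s x) (k : ℕ) :
    Indep (h.filtration k)
      (MeasurableSpace.comap (fun ω => (V k ω, Z k ω, s k ω)) inferInstance) Pr := by
  have h1 : IndepFun (fun ω (j : Finset.range k) => (V j ω, Z j ω, s j ω))
      (fun ω => (V k ω, Z k ω, s k ω)) Pr := by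
    have := h.indep.indepFun_finset (Finset.range k) {k} (by simp) h.measurable_noise
    exact this.comp (φ := id) 
      (ψ := fun p : ({k} : Finset ℕ) → ℝ × EuclideanSpace ℝ (Fin n) × S =>
        p ⟨k, Finset.mem_singleton_self k⟩) measurable_id (measurable_pi_apply _)
  have h2 : IndepFun (x 0) (fun ω => ((fun j : Finset.range k => (V j ω, Z j ω, s j ω)),
      (V k ω, Z k ω, s k ω))) Pr := by
    refine h.indep_init.comp (φ := id) (ψ := fun p : ℕ → ℝ × EuclideanSpace ℝ (Fin n) × S =>
      ((fun j : Finset.range k => p j), p k)) measurable_id ?_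
    exact (measurable_pi_iff.2 fun j => measurable_pi_apply _).prodMk (measurable_pi_apply _)
  have h3 := h2.prodMk_left_of_prodMk h.measurable_init
    (measurable_pi_iff.2 fun j : Finset.range k => h.measurable_noise j) (h.measurable_noise k) h1
  exact (IndepFun_iff_Indep _ _ _).1 h3

end IsRun

end Run

/-! ### Two facts about real sequences. -/

/-- If `∑ γ_k = ∞` and the weighted partial sums `∑ γ_k e_k` are bounded, the only possible limit
of `e` is zero. -/
lemma eq_zero_of_tendsto_of_sum_mul_le {γ e : ℕ → ℝ} {C ℓ : ℝ} (hγ : ∀ k, 0 ≤ γ k)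
    (he : ∀ k, 0 ≤ e k) (hsum : Tendsto (fun N => ∑ k ∈ Finset.range N, γ k) atTop atTop)
    (hC : ∀ N, ∑ k ∈ Finset.range N, γ k * e k ≤ C) (hℓ : Tendsto e atTop (𝓝 ℓ)) : ℓ = 0 := by
  by_contra hne
  have hpos : 0 < ℓ := lt_of_le_of_ne (ge_of_tendsto' hℓ he) (Ne.symm hne)
  have h1 : Summable fun k => γ k * e k :=
    summable_of_sum_range_le (fun k => mul_nonneg (hγ k) (he k)) hC
  have h2 : Summable γ := by
    refine Summable.of_norm_bounded_eventually_nat (h1.mul_left (2 / ℓ)) ?_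
    filter_upwards [hℓ.eventually (lt_mem_nhds (half_lt_self hpos))] with k hk
    rw [Real.norm_of_nonneg (hγ k)]
    have h3 : 1 ≤ 2 / ℓ * e k := by
      rw [div_mul_eq_mul_div, le_div_iff₀ hpos]; linarith
    calc γ k = γ k * 1 := (mul_one _).symm
      _ ≤ γ k * (2 / ℓ * e k) := mul_le_mul_of_nonneg_left h3 (hγ k)
      _ = _ := by ring
  exact (not_summable_iff_tendsto_nat_atTop_of_nonneg hγ).2 hsum h2

/-- A sequence with the stochastic-gradient recursion is `O(1/k)`; boundedness takes care of the
first steps, where the contraction factor may be negative. -/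
lemma le_div_of_recursion {e : ℕ → ℝ} {t B D Q : ℝ} (ht : 1 < t) (hB : B ≤ (t - 1) * Q)
    (hD : ∀ k, e k ≤ D) (hDQ : (t + 1) * D ≤ Q) (hD0 : 0 ≤ D)
    (hrec : ∀ k : ℕ, 1 ≤ k → e (k + 1) ≤ (1 - t / k) * e k + B / k ^ 2) :
    ∀ k : ℕ, 1 ≤ k → e k ≤ Q / k := by
  have hQ : 0 ≤ Q := by nlinarith
  intro k hk
  induction k, hk using Nat.le_induction with
  | base =>
    have := hD 1
    simp only [Nat.cast_one, div_one]
    nlinarith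
  | succ k hk ih =>
    have hk0 : (1 : ℝ) ≤ k := by exact_mod_cast hk
    -- While `k ≤ t` the contraction factor is not positive and the recursion cannot be iterated;
    -- but then `k + 1 ≤ t + 1`, and the uniform bound `D` suffices.
    rcases le_or_gt (k : ℝ) t with hkt | hkt
    · rw [le_div_iff₀ (by positivity)]
      push_cast
      have := hD (k + 1)
      calc e (k + 1) * (k + 1) ≤ D * (k + 1) := by gcongr
        _ ≤ D * (t + 1) := by gcongr
        _ ≤ Q := by linarith
    · have h1 : 0 ≤ 1 - t / k := by
        rw [sub_nonneg, div_le_one (by linarith)]; exact hkt.le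
      calc e (k + 1) ≤ (1 - t / k) * e k + B / k ^ 2 := hrec k hk
        _ ≤ (1 - t / k) * (Q / k) + ((t - 1) * Q) / k ^ 2 := by gcongr
        -- This closes the induction because `(k - 1)(k + 1) ≤ k²`.
        _ = Q * (k - 1) / k ^ 2 := by field_simp; ring
        _ ≤ Q / (k + 1 : ℕ) := by
          push_cast
          rw [div_le_div_iff₀ (by positivity) (by positivity)]
          nlinarith

/-! ### One-step contraction and almost sure convergence. -/

section Run

variable {n : ℕ} {S Ω : Type*} [MeasurableSpace S] [mΩ : MeasurableSpace Ω]
  {X : Set (EuclideanSpace ℝ (Fin n))} {P : Measure S}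
  {Φ : EuclideanSpace ℝ (Fin n) → S → ℝ} {γ η : ℕ → ℝ} {Pr : Measure Ω}
  {V : ℕ → Ω → ℝ} {Z : ℕ → Ω → EuclideanSpace ℝ (Fin n)} {s : ℕ → Ω → S}
  {x : ℕ → Ω → EuclideanSpace ℝ (Fin n)}
  {f : EuclideanSpace ℝ (Fin n) → ℝ} {L₀ μ : ℝ} {xs : EuclideanSpace ℝ (Fin n)}

namespace IsRun

lemma measurable_iterate (h : IsRun X P Φ γ η Pr V Z s x) (hX : Convex ℝ X)
    (hne : X.Nonempty) (hΦ : Measurable (Function.uncurry Φ)) (k : ℕ) : Measurable (x k) :=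
  (h.measurable_filtration hX hne hΦ k).mono (h.filtration.le k) le_rfl

variable [IsProbabilityMeasure P]

lemma norm_sub_sq_le (h : IsRun X P Φ γ η Pr V Z s x) (hL : 0 ≤ L₀) (hμ : 0 < μ)
    (hΦ : MeanSquareLipschitz P Φ f L₀) (hf : StrongConvexOn X μ f) (hxs : xs ∈ optimalSet f X)
    (k : ℕ) (ω : Ω) : ‖x k ω - xs‖ ^ 2 ≤ 16 / 9 * (L₀ / μ) ^ 2 :=
  hf.norm_sub_sq_le hμ hL (hΦ.lipschitzWith hL) hxs (h.mem k ω)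

variable [IsProbabilityMeasure Pr]

lemma integrable_norm_sub_sq (h : IsRun X P Φ γ η Pr V Z s x) (hL : 0 ≤ L₀) (hμ : 0 < μ)
    (hΦ : MeanSquareLipschitz P Φ f L₀) (hf : StrongConvexOn X μ f) (hxs : xs ∈ optimalSet f X)
    (k : ℕ) : Integrable (fun ω => ‖x k ω - xs‖ ^ 2) Pr := by
  have hm := h.measurable_iterate hf.1 ⟨xs, hxs.1⟩ hΦ.measurable k
  refine Integrable.of_bound (by fun_prop) (16 / 9 * (L₀ / μ) ^ 2)
    (Eventually.of_forall fun ω => ?_)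
  rw [Real.norm_of_nonneg (by positivity)]
  exact h.norm_sub_sq_le hL hμ hΦ hf hxs k ω

/-- One step of the scheme contracts the mean square distance to the minimizer, on every event of
the past. -/
lemma setIntegral_step_le (h : IsRun X P Φ γ η Pr V Z s x) (hL : 0 ≤ L₀) (hμ : 0 < μ)
    (hX : Convex ℝ X)
    (hΦ : MeanSquareLipschitz P Φ f L₀) (hf : StrongConvexOn X μ f) (hxs : xs ∈ optimalSet f X)
    {k : ℕ} (hγ : 0 ≤ γ k) (hη : 0 < η k) {A : Set Ω} (hA : MeasurableSet[h.filtration k] A) :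
    ∫ ω in A, ‖x (k + 1) ω - xs‖ ^ 2 ∂Pr ≤ ∫ ω in A, ((1 - μ * γ k) * ‖x k ω - xs‖ ^ 2
      + (2 * L₀ * √n * (γ k * η k) + 4 * L₀ ^ 2 * n / Real.pi * γ k ^ 2)) ∂Pr := by
  have hstep := fun ω => hΦ.lintegral_step_le hL hη hγ (hf.mul_norm_sub_sq_le hxs (h.mem k ω))
  have hi : Integrable (fun ω => (1 - μ * γ k) * ‖x k ω - xs‖ ^ 2
      + (2 * L₀ * √n * (γ k * η k) + 4 * L₀ ^ 2 * n / Real.pi * γ k ^ 2)) Pr :=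
    ((h.integrable_norm_sub_sq hL hμ hΦ hf hxs k).const_mul _).add (integrable_const _)
  -- In extended nonnegative form the noise can be integrated out by Tonelli, without integrability
  -- on the product space.
  rw [← ENNReal.ofReal_le_ofReal_iff (integral_nonneg fun ω => (hstep ω).1),
    ofReal_integral_eq_lintegral_ofReal
      (h.integrable_norm_sub_sq hL hμ hΦ hf hxs (k + 1)).integrableOn
      (Eventually.of_forall fun ω => by positivity),
    ofReal_integral_eq_lintegral_ofReal hi.integrableOn
      (Eventually.of_forall fun ω => (hstep ω).1)]
  have hG : Measurable (Function.uncurry fun (y : EuclideanSpace ℝ (Fin n))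
      (ξ : ℝ × EuclideanSpace ℝ (Fin n) × S) =>
      ENNReal.ofReal (‖y - γ k • esGsEstimator Φ (η k) y ξ.1 ξ.2.1 ξ.2.2 - xs‖ ^ 2)) :=
    (((measurable_fst.sub ((measurable_esGsEstimator hΦ.measurable (η k)).const_smul
      (γ k))).sub_const xs).norm.pow_const 2).ennreal_ofReal
  calc ∫⁻ ω in A, ENNReal.ofReal (‖x (k + 1) ω - xs‖ ^ 2) ∂Pr
      ≤ ∫⁻ ω in A, ENNReal.ofReal (‖x k ω - γ k • esGsEstimator Φ (η k) (x k ω) (V k ω) (Z k ω)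
          (s k ω) - xs‖ ^ 2) ∂Pr := by
        refine lintegral_mono fun ω => ENNReal.ofReal_le_ofReal ?_
        gcongr
        exact (h.step k ω).norm_sub_le hX (isProjection_self hxs.1)
    _ = ∫⁻ ω in A, ∫⁻ ξ, ENNReal.ofReal (‖x k ω - γ k • esGsEstimator Φ (η k) (x k ω) ξ.1 ξ.2.1
          ξ.2.2 - xs‖ ^ 2) ∂(noiseLaw n (η k) P) ∂Pr := by
        rw [show noiseLaw n (η k) P = _ from (h.law k).symm]
        exact setLIntegral_comp_of_indep (h.filtration.le k) (h.measurable_noise k)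
          (h.indep_filtration_noise k) (h.measurable_filtration hX ⟨xs, hxs.1⟩ hΦ.measurable k) hA hG
    _ ≤ _ := lintegral_mono fun ω => (hstep ω).2

lemma integral_step_le (h : IsRun X P Φ γ η Pr V Z s x) (hL : 0 ≤ L₀) (hμ : 0 < μ)
    (hX : Convex ℝ X)
    (hΦ : MeanSquareLipschitz P Φ f L₀) (hf : StrongConvexOn X μ f) (hxs : xs ∈ optimalSet f X)
    {k : ℕ} (hγ : 0 ≤ γ k) (hη : 0 < η k) :
    ∫ ω, ‖x (k + 1) ω - xs‖ ^ 2 ∂Pr ≤ (1 - μ * γ k) * ∫ ω, ‖x k ω - xs‖ ^ 2 ∂Pr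
      + (2 * L₀ * √n * (γ k * η k) + 4 * L₀ ^ 2 * n / Real.pi * γ k ^ 2) := by
  have h1 := h.setIntegral_step_le hL hμ hX hΦ hf hxs hγ hη (A := Set.univ) MeasurableSet.univ
  rw [setIntegral_univ, setIntegral_univ, integral_add
    ((h.integrable_norm_sub_sq hL hμ hΦ hf hxs k).const_mul _) (integrable_const _),
    integral_const_mul] at h1
  simpa using h1

/-- Almost sure convergence, by comparison with a bounded supermartingale. -/
lemma ae_tendsto (h : IsRun X P Φ γ η Pr V Z s x) (hL : 0 ≤ L₀) (hμ : 0 < μ)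
    (hX : Convex ℝ X)
    (hΦ : MeanSquareLipschitz P Φ f L₀) (hf : StrongConvexOn X μ f) (hxs : xs ∈ optimalSet f X)
    (hs : StepSequences γ η) : ∀ᵐ ω ∂Pr, Tendsto (fun k => x k ω) atTop (𝓝 xs) := by
  set c : ℕ → ℝ := fun k =>
    2 * L₀ * √n * (γ k * η k) + 4 * L₀ ^ 2 * n / Real.pi * γ k ^ 2 with hc
  have hpi := Real.pi_pos
  have hc0 : ∀ k, 0 ≤ c k := fun k => by
    have := hs.γ_pos k; have := hs.η_pos k; positivity
  have hcs : Summable c := (hs.sum_γ_η.mul_left _).add (hs.sum_γ_sq.mul_left _)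
  have hcC : ∀ N, ∑ k ∈ Finset.range N, c k ≤ ∑' k, c k := fun N =>
    hcs.sum_le_tsum _ fun k _ => hc0 k
  have hi := h.integrable_norm_sub_sq hL hμ hΦ hf hxs
  have hb := h.norm_sub_sq_le hL hμ hΦ hf hxs
  set D : ℝ := 16 / 9 * (L₀ / μ) ^ 2
  -- Adding back the accumulated errors absorbs the positive drift, and the sign makes `Y` a
  -- submartingale; it is bounded because `X` is bounded and `c` is summable.
  set Y : ℕ → Ω → ℝ := fun k ω => ∑ j ∈ Finset.range k, c j - ‖x k ω - xs‖ ^ 2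
  have hY : ∀ k, Integrable (Y k) Pr := fun k => (integrable_const _).sub (hi k)
  have hsub : Submartingale Y h.filtration Pr := by
    refine submartingale_of_setIntegral_le_succ (fun k => ?_) hY fun k A hA => ?_
    · have := h.measurable_filtration hX ⟨xs, hxs.1⟩ hΦ.measurable k
      have hg : Measurable fun y : EuclideanSpace ℝ (Fin n) =>
        ∑ j ∈ Finset.range k, c j - ‖y - xs‖ ^ 2 := by fun_prop
      exact (hg.comp this).stronglyMeasurable
    · have h1 := h.setIntegral_step_le hL hμ hX hΦ hf hxs (hs.γ_pos k).le (hs.η_pos k) hA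
      have h2 : ∫ ω in A, ((1 - μ * γ k) * ‖x k ω - xs‖ ^ 2 + c k) ∂Pr
          ≤ ∫ ω in A, (‖x k ω - xs‖ ^ 2 + c k) ∂Pr := by
        refine integral_mono (((hi k).const_mul _).add (integrable_const _)).integrableOn
          ((hi k).add (integrable_const _)).integrableOn fun ω => ?_
        have := mul_nonneg (mul_nonneg hμ.le (hs.γ_pos k).le) (sq_nonneg ‖x k ω - xs‖)
        simp only
        linarith
      have h3 := h1.trans h2
      simp only [Y]
      rw [integral_sub (integrable_const _) (hi _).integrableOn,
        integral_sub (integrable_const _) (hi _).integrableOn]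
      rw [integral_add (hi _).integrableOn (integrable_const _)] at h3
      simp only [Finset.sum_range_succ, setIntegral_const, smul_eq_mul, mul_add] at h3 ⊢
      linarith
  have hbdd : ∀ k, eLpNorm (Y k) 1 Pr ≤ ((∑' k, c k) + D).toNNReal := fun k => by
    refine (eLpNorm_le_of_ae_bound (C := (∑' k, c k) + D) (Eventually.of_forall fun ω => ?_)).trans
      ?_
    · rw [Real.norm_eq_abs, abs_le]
      have h1 := hcC k
      have h2 := Finset.sum_nonneg fun j (_ : j ∈ Finset.range k) => hc0 j
      have h3 := hb k ω
      have h4 := sq_nonneg ‖x k ω - xs‖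
      constructor <;> simp only [Y] <;> linarith
    · simp [ENNReal.ofReal]
  have hlim := hsub.ae_tendsto_limitProcess hbdd
  set W : Ω → ℝ := fun ω => ∑' k, c k - Filtration.limitProcess Y h.filtration Pr ω
  have hVW : ∀ᵐ ω ∂Pr, Tendsto (fun k => ‖x k ω - xs‖ ^ 2) atTop (𝓝 (W ω)) := by
    filter_upwards [hlim] with ω hω
    refine (hcs.hasSum.tendsto_sum_nat.sub hω).congr fun k => ?_
    simp [Y]
  have hE : Tendsto (fun k => ∫ ω, ‖x k ω - xs‖ ^ 2 ∂Pr) atTop (𝓝 (∫ ω, W ω ∂Pr)) := by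
    refine tendsto_integral_of_dominated_convergence (fun _ => D) (fun k => (hi k).1)
      (integrable_const _) (fun k => Eventually.of_forall fun ω => ?_) hVW
    rw [Real.norm_of_nonneg (by positivity)]
    exact hb k ω
  have hsum : ∀ N, ∑ k ∈ Finset.range N, γ k * ∫ ω, ‖x k ω - xs‖ ^ 2 ∂Pr
      ≤ μ⁻¹ * (∫ ω, ‖x 0 ω - xs‖ ^ 2 ∂Pr + ∑' k, c k) := by
    -- Telescoping the unconditional recursion, with the contraction term `μ γ_k E‖x_k - x*‖²` kept
    -- on the left.
    have key : ∀ N, μ * ∑ k ∈ Finset.range N, γ k * ∫ ω, ‖x k ω - xs‖ ^ 2 ∂Pr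
        + ∫ ω, ‖x N ω - xs‖ ^ 2 ∂Pr
        ≤ ∫ ω, ‖x 0 ω - xs‖ ^ 2 ∂Pr + ∑ k ∈ Finset.range N, c k := by
      intro N
      induction N with
      | zero => simp
      | succ N ih =>
        have h1 := h.integral_step_le hL hμ hX hΦ hf hxs (hs.γ_pos N).le (hs.η_pos N)
        rw [Finset.sum_range_succ, Finset.sum_range_succ]
        change _ ≤ _ + c N at h1
        linarith
    intro N
    rw [inv_mul_eq_div, le_div_iff₀ hμ]
    have h1 := key N
    have h2 := hcC N
    have h3 : 0 ≤ ∫ ω, ‖x N ω - xs‖ ^ 2 ∂Pr := integral_nonneg fun ω => sq_nonneg _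
    linarith
  have hW0 : ∀ᵐ ω ∂Pr, 0 ≤ W ω := by
    filter_upwards [hVW] with ω hω using ge_of_tendsto' hω fun k => sq_nonneg _
  have hWD : ∀ᵐ ω ∂Pr, W ω ≤ D := by
    filter_upwards [hVW] with ω hω using le_of_tendsto' hω fun k => hb k ω
  have hWm : AEStronglyMeasurable W Pr := aestronglyMeasurable_of_tendsto_ae atTop
    (fun k => (hi k).1) hVW
  have hWi : Integrable W Pr := Integrable.of_bound hWm D (by
    filter_upwards [hW0, hWD] with ω h0 h1
    rwa [Real.norm_of_nonneg h0])
  have hint : ∫ ω, W ω ∂Pr = 0 := eq_zero_of_tendsto_of_sum_mul_le (fun k => (hs.γ_pos k).le)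
    (fun k => integral_nonneg fun ω => sq_nonneg _) hs.sum_γ hsum hE
  have hWz := (integral_eq_zero_iff_of_nonneg_ae hW0 hWi).1 hint
  filter_upwards [hVW, hWz] with ω hω hz
  rw [hz] at hω
  rw [tendsto_iff_norm_sub_tendsto_zero]
  have h1 := hω.sqrt
  simpa using h1

end IsRun

end Run

/-! ### The mean-square rate. -/

section Rate

variable {n : ℕ} {S Ω : Type*} [MeasurableSpace S] [MeasurableSpace Ω]
  {X : Set (EuclideanSpace ℝ (Fin n))} {P : Measure S} [IsProbabilityMeasure P]
  {Φ : EuclideanSpace ℝ (Fin n) → S → ℝ} {γ η : ℕ → ℝ} {Pr : Measure Ω} [IsProbabilityMeasure Pr]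
  {V : ℕ → Ω → ℝ} {Z : ℕ → Ω → EuclideanSpace ℝ (Fin n)} {s : ℕ → Ω → S}
  {x : ℕ → Ω → EuclideanSpace ℝ (Fin n)}
  {f : EuclideanSpace ℝ (Fin n) → ℝ} {L₀ μ : ℝ} {xs : EuclideanSpace ℝ (Fin n)}

namespace IsRun

/-- The `O(1/k)` rate in mean square. -/
lemma integral_norm_sub_sq_le_div (h : IsRun X P Φ γ η Pr V Z s x) (hL : 0 ≤ L₀) (hμ : 0 < μ)
    (hX : Convex ℝ X)
    (hΦ : MeanSquareLipschitz P Φ f L₀) (hf : StrongConvexOn X μ f) (hxs : xs ∈ optimalSet f X)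
    {θ : ℝ} (hθ : 1 / μ < θ) (hstep : ∀ k : ℕ, 1 ≤ k → γ k = θ / k ∧ η k = θ / k) (hn : 1 ≤ n)
    {Q : ℝ} (hQ : θ ^ 2 * (4 * L₀ * √((n : ℝ) + 1) + 8 * L₀ ^ 2 * n / Real.pi)
      * (μ * θ - 1)⁻¹ ≤ Q) :
    ∀ k : ℕ, 1 ≤ k → ∫ ω, ‖x k ω - xs‖ ^ 2 ∂Pr ≤ Q / k := by
  have hpi := Real.pi_pos
  have hθ0 : 0 < θ := (by positivity : 0 < 1 / μ).trans hθ
  have ht : 1 < μ * θ := by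
    rw [div_lt_iff₀ hμ] at hθ; linarith
  have ht1 : 0 < μ * θ - 1 := by linarith
  have hn1 : (1 : ℝ) ≤ n := by exact_mod_cast hn
  rw [← div_eq_mul_inv, div_le_iff₀ ht1] at hQ
  refine le_div_of_recursion (t := μ * θ) (D := 16 / 9 * (L₀ / μ) ^ 2) ht
    (hQ.trans_eq (mul_comm _ _)) (fun k => ?_) ?_ (by positivity) fun k hk => ?_
  · calc ∫ ω, ‖x k ω - xs‖ ^ 2 ∂Pr ≤ ∫ _, 16 / 9 * (L₀ / μ) ^ 2 ∂Pr :=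
          integral_mono (h.integrable_norm_sub_sq hL hμ hΦ hf hxs k) (integrable_const _)
            fun ω => h.norm_sub_sq_le hL hμ hΦ hf hxs k ω
      _ = _ := by simp
  · have h1 : 16 / 9 * L₀ ^ 2 ≤ 8 * L₀ ^ 2 * n / Real.pi := by
      rw [le_div_iff₀ hpi]
      have h2 : 16 / 9 * Real.pi ≤ 8 * n := by linarith [Real.pi_lt_four, Real.pi_lt_d2]
      nlinarith [mul_le_mul_of_nonneg_left h2 (sq_nonneg L₀)]
    have h3 : 0 ≤ 4 * L₀ * √((n : ℝ) + 1) := by positivity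
    have h4 : θ ^ 2 * (16 / 9 * L₀ ^ 2) ≤ Q * (μ * θ - 1) :=
      (mul_le_mul_of_nonneg_left (by linarith) (sq_nonneg θ)).trans hQ
    have h5 : θ ^ 2 * (16 / 9 * L₀ ^ 2) = (μ * θ) ^ 2 * (16 / 9 * (L₀ / μ) ^ 2) := by
      field_simp
    have h6 : 0 ≤ 16 / 9 * (L₀ / μ) ^ 2 := by positivity
    refine le_of_mul_le_mul_right ?_ ht1
    calc (μ * θ + 1) * (16 / 9 * (L₀ / μ) ^ 2) * (μ * θ - 1)
        = ((μ * θ) ^ 2 - 1) * (16 / 9 * (L₀ / μ) ^ 2) := by ring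
      _ ≤ (μ * θ) ^ 2 * (16 / 9 * (L₀ / μ) ^ 2) := by
        refine mul_le_mul_of_nonneg_right (by linarith) h6
      _ ≤ Q * (μ * θ - 1) := by rw [← h5]; exact h4
  · have hk0 : (0 : ℝ) < k := by exact_mod_cast hk
    obtain ⟨e1, e2⟩ := hstep k hk
    have hγ : 0 < γ k := by rw [e1]; positivity
    have h1 := h.integral_step_le hL hμ hX hΦ hf hxs hγ.le (by rw [e2]; positivity)
    refine h1.trans ?_
    rw [e1, e2, ← mul_div_assoc]
    gcongr
    have h2 : √(n : ℝ) ≤ √((n : ℝ) + 1) := Real.sqrt_le_sqrt (by linarith)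
    -- The stated constants are at least twice those of the recursion.
    calc 2 * L₀ * √n * (θ / k * (θ / k)) + 4 * L₀ ^ 2 * n / Real.pi * (θ / k) ^ 2
        = θ ^ 2 * (2 * L₀ * √n + 4 * L₀ ^ 2 * n / Real.pi) / k ^ 2 := by field_simp
      _ ≤ θ ^ 2 * (4 * L₀ * √((n : ℝ) + 1) + 8 * L₀ ^ 2 * n / Real.pi) / k ^ 2 := by
        gcongr <;> norm_num

end IsRun

/-- Linear growth in the dimension: `√(n + 1) ≤ 2n` and `1 ≤ n` once `n ≥ 1`, which produces the
constant `C`. -/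
lemma max_le_mul_natCast {L A a : ℝ} (hL : 0 ≤ L) (hA : 0 ≤ A) {n : ℕ} (hn : 1 ≤ n) :
    max (A * (4 * L * √((n : ℝ) + 1) + 8 * L ^ 2 * n / Real.pi)) (a ^ 2)
      ≤ (A * (8 * L + 8 * L ^ 2 / Real.pi) + a ^ 2) * n := by
  have hpi := Real.pi_pos
  have hn1 : (1 : ℝ) ≤ n := by exact_mod_cast hn
  have h1 : √((n : ℝ) + 1) ≤ 2 * n := by
    rw [Real.sqrt_le_left (by positivity)]
    nlinarith
  have h2 : 0 ≤ A * (8 * L + 8 * L ^ 2 / Real.pi) := by positivity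
  refine max_le ?_ ?_
  · calc A * (4 * L * √((n : ℝ) + 1) + 8 * L ^ 2 * n / Real.pi)
        ≤ A * (4 * L * (2 * n) + 8 * L ^ 2 * n / Real.pi) := by gcongr
      _ = A * (8 * L + 8 * L ^ 2 / Real.pi) * n := by ring
      _ ≤ _ := by
        gcongr
        linarith [sq_nonneg a]
  · nlinarith [sq_nonneg a]

end Rate

theorem proposition4p4 :
    ∃ C : ℝ → ℝ → ℝ → ℝ → ℝ, ∀ (n : ℕ) (S Ω : Type*) [MeasurableSpace S] [MeasurableSpace Ω]
      (P : Measure S) [IsProbabilityMeasure P] (Pr : Measure Ω) [IsProbabilityMeasure Pr]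
      (X : Set (EuclideanSpace ℝ (Fin n))) (Φ : EuclideanSpace ℝ (Fin n) → S → ℝ)
      (f : EuclideanSpace ℝ (Fin n) → ℝ) (L₀ μ : ℝ) (γ η : ℕ → ℝ) (V : ℕ → Ω → ℝ)
      (Z : ℕ → Ω → EuclideanSpace ℝ (Fin n)) (s : ℕ → Ω → S)
      (x : ℕ → Ω → EuclideanSpace ℝ (Fin n)),
      Convex ℝ X → 0 ≤ L₀ → 0 < μ →
      IsAdmissible P Φ f L₀ → StrongConvexOn X μ f → (optimalSet f X).Nonempty →
      IsRun X P Φ γ η Pr V Z s x →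
      -- almost sure convergence to the unique minimizer
      (StepSequences γ η →
        ∃ xstar, optimalSet f X = {xstar} ∧
          ∀ᵐ ω ∂Pr, Tendsto (fun k => x k ω) atTop (𝓝 xstar)) ∧
      -- convergence in mean, with a rate
      (∀ θ : ℝ, 1 / μ < θ → 0 ≤ γ 0 → 0 < η 0 → (∀ k : ℕ, 1 ≤ k → γ k = θ / k ∧ η k = θ / k) →
        ∃ xstar, optimalSet f X = {xstar} ∧
          (∀ k, Integrable (fun ω => ‖x k ω - xstar‖ ^ 2) Pr) ∧
          Tendsto (fun k => ∫ ω, ‖x k ω - xstar‖ ∂Pr) atTop (𝓝 0) ∧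
          ∀ a₀ : ℝ, 0 ≤ a₀ → a₀ ^ 2 = ∫ ω, ‖x 0 ω - xstar‖ ^ 2 ∂Pr → ∀ k : ℕ, 1 ≤ k →
            ∫ ω, ‖x k ω - xstar‖ ^ 2 ∂Pr ≤
              max (θ ^ 2 * (4 * L₀ * √((n : ℝ) + 1) + 8 * L₀ ^ 2 * n / Real.pi)
                * (μ * θ - 1)⁻¹) (a₀ ^ 2) / k ∧
            ∫ ω, ‖x k ω - xstar‖ ^ 2 ∂Pr ≤ C L₀ μ θ a₀ * n / k) := by
  refine ⟨fun L μ θ a => θ ^ 2 * (μ * θ - 1)⁻¹ * (8 * L + 8 * L ^ 2 / Real.pi) + a ^ 2, ?_⟩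
  intro n S Ω _ _ P _ Pr _ X Φ f L₀ μ γ η V Z s x hX hL hμ hadm hf ⟨xs, hxs⟩ hrun
  have hΦ := hadm.meanSquareLipschitz hL
  have huniq := hf.optimalSet_eq_singleton hμ hxs
  refine ⟨fun hs => ⟨xs, huniq, hrun.ae_tendsto hL hμ hX hΦ hf hxs hs⟩, ?_⟩
  intro θ hθ _ _ hstep
  have hi := hrun.integrable_norm_sub_sq hL hμ hΦ hf hxs
  have ht1 : 0 < μ * θ - 1 := by rw [div_lt_iff₀ hμ] at hθ; linarith
  -- In dimension zero the comparison of the diameter with the rate constant breaks down, but the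
  -- space is a single point and every distance is zero.
  have hzero : n = 0 → ∀ k ω, ‖x k ω - xs‖ = 0 := by
    rintro rfl k ω
    rw [Subsingleton.elim (x k ω) xs, sub_self, norm_zero]
  have hrate : ∀ Q : ℝ, 0 ≤ Q → θ ^ 2 * (4 * L₀ * √((n : ℝ) + 1) + 8 * L₀ ^ 2 * n / Real.pi)
      * (μ * θ - 1)⁻¹ ≤ Q → ∀ k : ℕ, 1 ≤ k → ∫ ω, ‖x k ω - xs‖ ^ 2 ∂Pr ≤ Q / k := by
    intro Q hQ0 hQ k hk
    rcases Nat.eq_zero_or_pos n with hn | hn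
    · simp only [hzero hn]
      simp
      positivity
    · exact hrun.integral_norm_sub_sq_le_div hL hμ hX hΦ hf hxs hθ hstep hn hQ k hk
  refine ⟨xs, huniq, hi, ?_, fun a₀ _ _ k hk => ?_⟩
  -- Convergence in mean follows from the rate by Cauchy–Schwarz; here `a₀` is absent, and the
  -- maximum with 0 only supplies the sign of `Q`.
  · set Q := max (θ ^ 2 * (4 * L₀ * √((n : ℝ) + 1) + 8 * L₀ ^ 2 * n / Real.pi)
      * (μ * θ - 1)⁻¹) 0
    have hlim : Tendsto (fun k : ℕ => √(Q / k)) atTop (𝓝 0) := by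
      have := (tendsto_const_div_atTop_nhds_zero_nat Q).sqrt
      rwa [Real.sqrt_zero] at this
    refine squeeze_zero' (Eventually.of_forall fun k => integral_nonneg fun ω => norm_nonneg _) ?_
      hlim
    filter_upwards [eventually_ge_atTop 1] with k hk
    have hm := hrun.measurable_iterate hX ⟨xs, hxs.1⟩ hΦ.measurable k
    have hmem : MemLp (fun ω => ‖x k ω - xs‖) 2 Pr :=
      (memLp_two_iff_integrable_sq (by fun_prop)).2 (hi k)
    refine (le_abs_self _).trans (Real.abs_le_sqrt ?_)
    exact (sq_integral_le_integral_sq hmem).trans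
      (hrate Q (le_max_right _ _) (le_max_left _ _) k hk)
  · have h1 := hrate _ ((sq_nonneg a₀).trans (le_max_right _ _)) (le_max_left _ (a₀ ^ 2)) k hk
    refine ⟨h1, ?_⟩
    rcases Nat.eq_zero_or_pos n with hn | hn
    · simp only [hzero hn]
      simp [hn]
    · refine h1.trans ?_
      have h2 := max_le_mul_natCast (L := L₀) (A := θ ^ 2 * (μ * θ - 1)⁻¹) (a := a₀) hL
        (by positivity) hn
      rw [mul_right_comm] at h2
      gcongr
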